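/- Let $0 \le r < n$ be integers. Superspace is $\Omega_n = \mathbb{Q}[x_1,\dots,x_n] \otimes \bigwedge(\theta_1,\dots,\theta_n)$, with commuting variables $x_i$ and anticommuting variables $\theta_i$, and with the $\mathfrak{S}_n$-action $w\cdot x_i = x_{w(i)}$, $w\cdot\theta_i=\theta_{w(i)}$. Let $\mathbf{a}=(0,\dots,0)$ be the zero sequence of length $r$ and put $$\Delta_n(\mathbf a) = \sum_{w\in\mathfrak{S}_n} \mathrm{sign}(w)\, w\cdot\bigl(x_{r+1}^{\,n-r-1} x_{r+2}^{\,n-r-2}\cdots x_{n-1}^{1}x_n^{0}\;\theta_1\cdots\theta_r\bigr).$$ Let $\partial_i$ be the partial derivative with respect to $x_i$ on $\Omega_n$ (the $\theta$-variables being constants); for $f\in\mathbb{Q}[x_1,\dots,x_n]$ let $\partial(f)$ be the operator obtained from $f$ by replacing each $x_i$ by $\partial_i$. Let $V_n(\mathbf a)$ be the smallest $\mathbb{Q}$-subspace of $\Omega_n$ that contains $\Delta_n(\mathbf a)$ and is closed under $\partial_1,\dots,\partial_n$; it is $\mathfrak{S}_n$-stable and graded by $x$-degree. For a partition $\lambda\vdash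 n$ with conjugate $\lambda'=(\lambda'_1\ge\dots\ge\lambda'_n\ge 0)$, the Tanisaki ideal $I_\lambda\subseteq\mathbb{Q}[x_1,\dots,x_n]$ is generated by the elementary symmetric polynomials $e_d(S)$ of degree $d$ in the variables $\{x_i : i\in S\}$, for all $\emptyset\ne S\subseteq\{1,\dots,n\}$ and all $d > |S| - (\lambda'_{n-|S|+1}+\dots+\lambda'_n)$, where $e_d(S)=0$ for $d>|S|$. Let $R_\lambda = \mathbb{Q}[x_1,\dots,x_n]/I_\lambda$, a graded $\mathfrak{S}_n$-module. Let $\lambda=(r+1,1,\dots,1)\vdash n$. Then: 1. $I_\lambda=\{f\in\mathbb{Q}[x_1,\dots,x_n] : \partial(f)(\Delta_n(\mathbf a))=0\}$. 2. Put $D=\binom{n-r}{2}$. The components of degree greater than $D$ of $R_\lambda$ and of $V_n(\mathbf a)$ vanish, and there is a $\mathbb{Q}$-linear isomorphism $\varphi: R_\lambda\to V_n(\mathbf a)$ such that $\varphi(w\cdot f)=\mathrm{sign}(w)\,w\cdot\varphi(f)$ for all $w\in\mathfrak{S}_n$ and $f\in R_\lambda$, and such that $\varphi$ maps the component of degree $i$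 of $R_\lambda$ onto the component of degree $D-i$ of $V_n(\mathbf a)$ for $0\le i\le D$. 3. The graded Frobenius images are polynomials in $q$, and $$\mathrm{grFrob}(V_n(\mathbf a);q) = (\mathrm{rev}_q\circ\omega)\,\mathrm{grFrob}(R_\lambda;q).$$ Here $\mathrm{grFrob}(M;q)=\sum_{d\ge0}\mathrm{Frob}(M_d)\,q^d$ for a graded $\mathfrak{S}_n$-module $M$; $\mathrm{Frob}(N)=\frac1{n!}\sum_{w\in\mathfrak{S}_n}\chi_N(w)\,p_{\mathrm{cyc}(w)}$ is the Frobenius characteristic of a finite-dimensional $\mathfrak{S}_n$-module $N$ with character $\chi_N$, a symmetric function of degree $n$ (written as a symmetric polynomial in $n$ variables), where $p_\mu$ is the power sum symmetric function and $\mathrm{cyc}(w)$ the cycle type of $w$; $\omega$ is the algebra endomorphism with $\omega(e_i)=h_i$ for $1\le i\le n$, applied to the coefficients; and $\mathrm{rev}_q(c_dq^d+\dots+c_1q+c_0)=c_0q^d+c_1q^{d-1}+\dots+c_d$ if $c_d\ne0$. -/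

import Mathlib

open scoped TensorProduct PowerSeries Polynomial

noncomputable section

namespace SuperVandermonde

/-! ### Superspace, its symmetric group action and its differential operators -/

/-- Superspace of rank `n`, `ℚ[x₁, …, xₙ] ⊗ ⋀(θ₁, …, θₙ)`: the commuting variables are `X i ⊗ 1`
and the anticommuting variables are `θ n i`.  Indices run over `Fin n`, i.e. start at `0`. -/
abbrev Superspace (n : ℕ) : Type :=
  MvPolynomial (Fin n) ℚ ⊗[ℚ] ExteriorAlgebra ℚ (Fin n →₀ ℚ)

/-- The anticommuting variable `θ_i`. -/
def theta (n : ℕ) (i : Fin n) : Superspace n :=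
  1 ⊗ₜ[ℚ] ExteriorAlgebra.ι ℚ (Finsupp.single i 1)

/-- A polynomial in the commuting variables, viewed in superspace. -/
def ofPoly {n : ℕ} (f : MvPolynomial (Fin n) ℚ) : Superspace n := f ⊗ₜ[ℚ] 1

/-- The algebra automorphism of superspace with `x_i ↦ x_{w i}` and `θ_i ↦ θ_{w i}`. -/
def superPerm {n : ℕ} (w : Equiv.Perm (Fin n)) : Superspace n →ₐ[ℚ] Superspace n :=
  Algebra.TensorProduct.map (MvPolynomial.rename w)
    (ExteriorAlgebra.map (Finsupp.lmapDomain ℚ ℚ w))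

lemma superPerm_one {n : ℕ} : superPerm (1 : Equiv.Perm (Fin n)) = AlgHom.id ℚ _ := by
  have h : Finsupp.lmapDomain ℚ ℚ (⇑(1 : Equiv.Perm (Fin n))) = LinearMap.id := by
    ext; simp
  have h' : MvPolynomial.rename (R := ℚ) (⇑(1 : Equiv.Perm (Fin n))) = AlgHom.id ℚ _ := by
    ext i; simp
  rw [superPerm, h, h', ExteriorAlgebra.map_id]
  exact Algebra.TensorProduct.map_id

lemma superPerm_mul {n : ℕ} (v w : Equiv.Perm (Fin n)) :
    superPerm (v * w) = (superPerm v).comp (superPerm w) := by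
  have h : Finsupp.lmapDomain ℚ ℚ (⇑(v * w)) =
      (Finsupp.lmapDomain ℚ ℚ v).comp (Finsupp.lmapDomain ℚ ℚ w) := by
    ext; simp
  have h' : MvPolynomial.rename (R := ℚ) (⇑(v * w)) =
      (MvPolynomial.rename v).comp (MvPolynomial.rename w) := by
    ext i; simp
  rw [superPerm, h, h', ← ExteriorAlgebra.map_comp_map, Algebra.TensorProduct.map_comp]
  rfl

/-- The diagonal action of the symmetric group on superspace. -/
def superRep (n : ℕ) : Representation ℚ (Equiv.Perm (Fin n)) (Superspace n) where
  toFun w := (superPerm w).toLinearMap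
  map_one' := by rw [superPerm_one]; rfl
  map_mul' v w := by rw [superPerm_mul]; rfl

/-- The partial derivative `∂_i` with respect to `x_i`, with the `θ`-variables as constants. -/
def superPartial {n : ℕ} (i : Fin n) : Module.End ℚ (Superspace n) :=
  TensorProduct.map (MvPolynomial.pderiv i).toLinearMap LinearMap.id

/-- The differential operator `∂(f)`, obtained from the polynomial `f` by replacing each `x_i`
by `∂_i`. -/
def diffOp {n : ℕ} (f : MvPolynomial (Fin n) ℚ) : Module.End ℚ (Superspace n) :=
  f.support.sum fun m => f.coeff m • (List.ofFn fun i : Fin n => superPartial i ^ m i).prod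

/-- The superpolynomials which are homogeneous of `x`-degree `d`. -/
def xDegree (n d : ℕ) : Submodule ℚ (Superspace n) :=
  Submodule.span ℚ {g | ∃ (p : MvPolynomial (Fin n) ℚ) (t : ExteriorAlgebra ℚ (Fin n →₀ ℚ)),
    p.IsHomogeneous d ∧ g = p ⊗ₜ[ℚ] t}

/-! ### The superspace Vandermonde and the module it generates -/

/-- The supermonomial
`x₁^{a₁} ⋯ x_r^{a_r} x_{r+1}^{k-1} x_{r+2}^{k-2} ⋯ x_{n-1}^1 x_n^0 · θ₁ θ₂ ⋯ θ_r`, `n = k + r`.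
For the `0`-based index `i ≥ r` the exponent `k - 1 - (i - r)` is `n - 1 - i`. -/
def startMonomial {n r : ℕ} (h : r ≤ n) (a : Fin r → ℕ) : Superspace n :=
  ofPoly (∏ i : Fin n, MvPolynomial.X i ^ (if hi : (i : ℕ) < r then a ⟨i, hi⟩ else n - 1 - i)) *
    (List.ofFn fun j : Fin r => theta n (Fin.castLE h j)).prod

/-- The `a`-superspace Vandermonde `Δ_n(a) = ∑_w sign(w) w · (start monomial)`. -/
def vandermonde {n r : ℕ} (h : r ≤ n) (a : Fin r → ℕ) : Superspace n :=
  ∑ w : Equiv.Perm (Fin n), ((Equiv.Perm.sign w : ℤ) : ℚ) • superRep n w (startMonomial h a)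

/-- `V_n(a)`: the smallest subspace containing `Δ_n(a)` and closed under `∂_1, …, ∂_n`. -/
def V {n r : ℕ} (h : r ≤ n) (a : Fin r → ℕ) : Submodule ℚ (Superspace n) :=
  sInf {U | vandermonde h a ∈ U ∧ ∀ i, ∀ g ∈ U, superPartial i g ∈ U}

lemma superRep_superPartial {n : ℕ} (w : Equiv.Perm (Fin n)) (i : Fin n) (g : Superspace n) :
    superRep n w (superPartial i g) = superPartial (w i) (superRep n w g) := by
  induction g using TensorProduct.induction_on with
  | zero => simp
  | add x y hx hy => simp only [map_add, hx, hy]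
  | tmul p t =>
    have := MvPolynomial.pderiv_rename (R := ℚ) w.injective i p
    simp [superRep, superPerm, superPartial, this]

lemma superRep_vandermonde {n r : ℕ} (h : r ≤ n) (a : Fin r → ℕ) (w : Equiv.Perm (Fin n)) :
    superRep n w (vandermonde h a) = ((Equiv.Perm.sign w : ℤ) : ℚ) • vandermonde h a := by
  unfold vandermonde
  rw [map_sum, Finset.smul_sum]
  refine Fintype.sum_equiv (Equiv.mulLeft w) _ _ fun v => ?_
  have hs : ((Equiv.Perm.sign w : ℤ) : ℚ) * ((Equiv.Perm.sign w : ℤ) : ℚ) = 1 := by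
    rcases Int.units_eq_one_or (Equiv.Perm.sign w) with h | h <;> simp [h]
  simp only [map_smul, Equiv.coe_mulLeft, map_mul, Units.val_mul, Int.cast_mul, smul_smul,
    ← mul_assoc, hs, one_mul, Module.End.mul_apply]

lemma vandermonde_mem_V {n r : ℕ} (h : r ≤ n) (a : Fin r → ℕ) : vandermonde h a ∈ V h a := by
  simp only [V, Submodule.mem_sInf]
  exact fun U hU => hU.1

lemma superPartial_mem_V {n r : ℕ} (h : r ≤ n) (a : Fin r → ℕ) (i : Fin n) {g : Superspace n}
    (hg : g ∈ V h a) : superPartial i g ∈ V h a := by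
  simp only [V, Submodule.mem_sInf] at hg ⊢
  exact fun U hU => hU.2 i g (hg U hU)

/-- `V_n(a)` is stable under the symmetric group. -/
lemma superRep_mem_V {n r : ℕ} (h : r ≤ n) (a : Fin r → ℕ) (w : Equiv.Perm (Fin n))
    {g : Superspace n} (hg : g ∈ V h a) : superRep n w g ∈ V h a := by
  have hle : V h a ≤ (V h a).comap (superRep n w) := by
    refine sInf_le ⟨?_, fun i g hg => ?_⟩
    · rw [Submodule.mem_comap, superRep_vandermonde]
      exact Submodule.smul_mem _ _ (vandermonde_mem_V h a)
    · rw [Submodule.mem_comap] at hg ⊢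
      rw [superRep_superPartial]
      exact superPartial_mem_V h a _ hg
  exact hle hg

lemma superRep_mem_xDegree {n d : ℕ} (w : Equiv.Perm (Fin n)) {g : Superspace n}
    (hg : g ∈ xDegree n d) : superRep n w g ∈ xDegree n d := by
  have hle : xDegree n d ≤ (xDegree n d).comap (superRep n w) := by
    refine Submodule.span_le.2 ?_
    rintro _ ⟨p, t, hp, rfl⟩
    refine Submodule.subset_span ⟨MvPolynomial.rename w p,
      ExteriorAlgebra.map (Finsupp.lmapDomain ℚ ℚ w) t, hp.rename_isHomogeneous, ?_⟩
    simp [superRep, superPerm]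
  exact hle hg

/-- The component of `x`-degree `d` of `V_n(a)`, as a representation of the symmetric group. -/
def VPiece {n r : ℕ} (h : r ≤ n) (a : Fin r → ℕ) (d : ℕ) : Subrepresentation (superRep n) where
  toSubmodule := V h a ⊓ xDegree n d
  apply_mem_toSubmodule w _ hg := ⟨superRep_mem_V h a w hg.1, superRep_mem_xDegree w hg.2⟩

/-! ### Tanisaki ideals and quotients -/

/-- The elementary symmetric polynomial `e_d(S)` in the variables `x_i`, `i ∈ S`. -/
def esymmOn {n : ℕ} (S : Finset (Fin n)) (d : ℕ) : MvPolynomial (Fin n) ℚ :=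
  ∑ T ∈ S.powersetCard d, ∏ i ∈ T, MvPolynomial.X i

/-- The `j`-th part (`j ≥ 1`) of the conjugate partition: the number of parts of `lam` which
are at least `j`. -/
def conjPart {n : ℕ} (lam : n.Partition) (j : ℕ) : ℕ :=
  (lam.parts.filter fun p => j ≤ p).card

/-- The generators of the Tanisaki ideal: all `e_d(S)` with `|S| = i ≥ 1` and
`d > i - (λ'_{n-i+1} + ⋯ + λ'_n)`. -/
def tanisakiGenerators {n : ℕ} (lam : n.Partition) : Set (MvPolynomial (Fin n) ℚ) :=
  {f | ∃ (S : Finset (Fin n)) (d : ℕ), 1 ≤ S.card ∧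
    S.card < d + ∑ j ∈ Finset.Icc (n - S.card + 1) n, conjPart lam j ∧ f = esymmOn S d}

/-- The Tanisaki ideal `I_λ`. -/
def tanisakiIdeal {n : ℕ} (lam : n.Partition) : Ideal (MvPolynomial (Fin n) ℚ) :=
  Ideal.span (tanisakiGenerators lam)

/-- The Tanisaki quotient `R_λ = ℚ[x₁, …, xₙ] / I_λ`. -/
abbrev TanisakiQuotient {n : ℕ} (lam : n.Partition) : Type :=
  MvPolynomial (Fin n) ℚ ⧸ tanisakiIdeal lam

lemma rename_esymmOn {n : ℕ} (w : Equiv.Perm (Fin n)) (S : Finset (Fin n)) (d : ℕ) :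
    MvPolynomial.rename w (esymmOn S d) = esymmOn (S.map w.toEmbedding) d := by
  unfold esymmOn
  rw [Finset.powersetCard_map, Finset.sum_map, map_sum]
  simp [Finset.prod_map, map_prod]

lemma tanisakiIdeal_le_comap {n : ℕ} (lam : n.Partition) (w : Equiv.Perm (Fin n)) :
    tanisakiIdeal lam ≤ (tanisakiIdeal lam).comap (MvPolynomial.rename (R := ℚ) w) := by
  refine Ideal.span_le.2 ?_
  rintro _ ⟨S, d, h1, h2, rfl⟩
  refine Ideal.subset_span ⟨S.map w.toEmbedding, d, ?_, ?_, rename_esymmOn w S d⟩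
  · simpa using h1
  · simpa using h2

/-- The action of the symmetric group on `R_λ` by permutation of the variables. -/
def tanisakiRep {n : ℕ} (lam : n.Partition) :
    Representation ℚ (Equiv.Perm (Fin n)) (TanisakiQuotient lam) where
  toFun w := (Ideal.quotientMapₐ (tanisakiIdeal lam) (MvPolynomial.rename (R := ℚ) w)
    (tanisakiIdeal_le_comap lam w)).toLinearMap
  map_one' := by
    refine LinearMap.ext fun f => ?_
    obtain ⟨f, rfl⟩ := Ideal.Quotient.mk_surjective f
    simp
  map_mul' v w := by
    refine LinearMap.ext fun f => ?_
    obtain ⟨f, rfl⟩ := Ideal.Quotient.mk_surjective f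
    simp [MvPolynomial.rename_rename]

/-- The component of degree `d` of `R_λ` (the classes of the homogeneous polynomials of degree
`d`), as a representation of the symmetric group. -/
def tanisakiPiece {n : ℕ} (lam : n.Partition) (d : ℕ) : Subrepresentation (tanisakiRep lam) where
  toSubmodule := (MvPolynomial.homogeneousSubmodule (Fin n) ℚ d).map
    (Ideal.Quotient.mkₐ ℚ (tanisakiIdeal lam)).toLinearMap
  apply_mem_toSubmodule w := by
    rintro _ ⟨p, hp, rfl⟩
    have hp' : p.IsHomogeneous d := hp
    exact ⟨MvPolynomial.rename w p, hp'.rename_isHomogeneous, by simp [tanisakiRep]⟩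

/-- The hook-shaped partition `(r + 1, 1, …, 1)` of `n`. -/
def hook {n r : ℕ} (h : r < n) : n.Partition where
  parts := (r + 1) ::ₘ Multiset.replicate (n - r - 1) 1
  parts_pos := by
    intro i hi
    rcases Multiset.mem_cons.1 hi with rfl | hi
    · omega
    · rw [Multiset.eq_of_mem_replicate hi]; exact one_pos
  parts_sum := by simp; omega

/-! ### Symmetric functions and Frobenius images -/

/-- Symmetric polynomials in `n` variables over `ℚ`.  Restriction of the symmetric functions in
infinitely many variables to `n` variables is bijective in all degrees `≤ n`, so Frobenius images
of representations of the symmetric group on `n` letters, which have degree `n`, may be taken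
here. -/
abbrev Sym (n : ℕ) : Type := MvPolynomial.symmetricSubalgebra (Fin n) ℚ

/-- The involution `ω`: the algebra endomorphism with `e_i ↦ h_i` for `1 ≤ i ≤ n` (in degrees
`≤ n` this is the usual involution `s_λ ↦ s_{λ'}`). -/
def omega (n : ℕ) : Sym n →ₐ[ℚ] Sym n :=
  (MvPolynomial.aeval fun i : Fin n =>
    (⟨MvPolynomial.hsymm (Fin n) ℚ (i + 1), MvPolynomial.hsymm_isSymmetric (Fin n) ℚ _⟩ :
      Sym n)).comp
    (MvPolynomial.esymmAlgEquiv (Fin n) ℚ (Fintype.card_fin n)).symm.toAlgHom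

/-- The power sum symmetric polynomial `p_μ`, where `μ` is the cycle type of `w` (fixed points
included). -/
def cyclePsum {n : ℕ} (w : Equiv.Perm (Fin n)) : Sym n :=
  (w.partition.parts.map fun m =>
    (⟨MvPolynomial.psum (Fin n) ℚ m, MvPolynomial.psum_isSymmetric (Fin n) ℚ m⟩ : Sym n)).prod

/-- The Frobenius image `Frob(M) = (1 / n!) ∑_w χ_M(w) p_{cycle type of w}` of a
finite-dimensional representation of the symmetric group; the irreducible representation `S^λ`
is sent to the Schur function `s_λ`. -/
def frob {n : ℕ} {M : Type} [AddCommGroup M] [Module ℚ M]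
    (ρ : Representation ℚ (Equiv.Perm (Fin n)) M) : Sym n :=
  (1 / (n.factorial : ℚ)) • ∑ w : Equiv.Perm (Fin n), ρ.character w • cyclePsum w

/-- The graded Frobenius image `∑_d Frob(M_d) q^d` of a sequence of subrepresentations `M_d`. -/
def grFrob {n : ℕ} {M : Type} [AddCommGroup M] [Module ℚ M]
    {ρ : Representation ℚ (Equiv.Perm (Fin n)) M} (P : ℕ → Subrepresentation ρ) : (Sym n)⟦X⟧ :=
  PowerSeries.mk fun d => frob (P d).toRepresentation

end SuperVandermonde

end

/-!
Write `k = n - r` and `Δ` for the superspace Vandermonde, and let `λ` be the hook.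

Collecting the terms of `Δ` by their `θ`-part, its coefficients are, up to nonzero constants, the
ordinary Vandermonde determinants in the `k`-element subsets of the variables
(`factorial_smul_vandermonde`, `superCoeff_vandermonde`).  So `∂(f)` annihilates `Δ` if and only if
it annihilates all these determinants.  On the other side, the Tanisaki ideal of `λ` is generated
by the `e_d` (`d ≥ 1`) of all the variables and the squarefree monomials of degree `k`
(`tanisakiIdeal_hook`).

The equality of the two ideals is proved in a relative form, for every set `S` of variables and
every `1 ≤ k ≤ |S|`; the variables outside `S` are put into the ideal (`hookIdeal`, `annIdeal`).

* The generators annihilate (`hookIdeal_le_annIdeal`): `∂(e_d)` maps a Vandermonde determinant to an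
  alternating polynomial of smaller degree, which is `0`, and every monomial of the determinant
  involves only `k - 1` variables.
* Conversely (`annIdeal_le_hookIdeal`), induct on `S` by removing a variable `x_m`.  Since
  `∂_m ^ (k - 1)` maps the Vandermonde determinant in `x_m` and `k - 1` further variables to a
  multiple of the one in the further variables, an annihilating element `x_m ^ j * g` has `g`
  annihilating the determinants in `k - 1` variables of `S \ {m}`.  By induction `g` lies in the
  smaller ideal, and `x_m ^ j` times that ideal is contained in the hook ideal modulo
  `x_m ^ (j + 1)`.  Thus an annihilating polynomial can be pushed into `(x_m ^ k)`, and `x_m ^ k`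
  belongs to the hook ideal.  No dimension count or monomial basis is needed.

The isomorphism is then `f ↦ ∂(f)(Δ)`; the sign twist comes from `w · Δ = sign(w) Δ` and the
reversal of degrees from `∂(f)` lowering degrees by the degree of `f`.  For the Frobenius images,
Newton's identities for the `e_m` and for the `h_m` give `ω(p_m) = (-1) ^ (m - 1) p_m`, hence
`ω` accounts for the twist of characters by the sign (`frob_eq_omega_frob`).  The reversal `rev_q`
is taken with respect to the actual degree in `q`; this degree is `k choose 2` because the
coefficient of `x₁ ⋯ xₙ` in a Frobenius image is the dimension of the representation, and the top
component of `R_λ` is not zero.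
-/

namespace SuperVandermonde

open MvPolynomial

/-! ### Polynomials in commuting operators -/

section OperatorAlgebra

open scoped IsMulCommutative

variable {n : ℕ} {M : Type*} [AddCommGroup M] [Module ℚ M]

/-- The algebra homomorphism `f ↦ f(D₁, …, Dₙ)` into the endomorphisms of a vector space, for
pairwise commuting endomorphisms `D i`.  It is the evaluation in the commutative subalgebra
generated by the `D i`. -/
noncomputable def evalOp (D : Fin n → Module.End ℚ M) (hD : ∀ i j, D i * D j = D j * D i) :
    MvPolynomial (Fin n) ℚ →ₐ[ℚ] Module.End ℚ M :=
  haveI : IsMulCommutative (Algebra.adjoin ℚ (Set.range D)) :=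
    Algebra.isMulCommutative_adjoin ℚ (by
      rintro _ ⟨i, rfl⟩ _ ⟨j, rfl⟩
      exact hD i j)
  (Algebra.adjoin ℚ (Set.range D)).val.comp
    (aeval fun i => ⟨D i, Algebra.subset_adjoin ⟨i, rfl⟩⟩)

@[simp] lemma evalOp_X (D : Fin n → Module.End ℚ M) (hD : ∀ i j, D i * D j = D j * D i)
    (i : Fin n) : evalOp D hD (X i) = D i := by
  simp [evalOp]

lemma evalOp_eq_sum (D : Fin n → Module.End ℚ M) (hD : ∀ i j, D i * D j = D j * D i)
    (f : MvPolynomial (Fin n) ℚ) :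
    evalOp D hD f =
      f.support.sum fun m => f.coeff m • (List.ofFn fun i : Fin n => D i ^ m i).prod := by
  conv_lhs => rw [f.as_sum, map_sum]
  refine Finset.sum_congr rfl fun m _ => ?_
  have : monomial m (f.coeff m) = f.coeff m • (List.ofFn fun i : Fin n => X i ^ m i).prod := by
    rw [List.prod_ofFn, monomial_eq, Finsupp.prod_fintype _ _ (by simp), smul_eq_C_mul]
  rw [this, map_smul, map_list_prod, List.map_ofFn]
  congr 3
  ext1 i
  simp

end OperatorAlgebra

/-! ### Differential operators on polynomials -/

section PolyDiff

variable {n : ℕ}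

lemma pderiv_mul_comm (i j : Fin n) :
    ((pderiv i).toLinearMap * (pderiv j).toLinearMap : Module.End ℚ (MvPolynomial (Fin n) ℚ)) =
      (pderiv j).toLinearMap * (pderiv i).toLinearMap := by
  have h : ⁅(pderiv i : Derivation ℚ (MvPolynomial (Fin n) ℚ) (MvPolynomial (Fin n) ℚ)),
      (pderiv j : Derivation ℚ (MvPolynomial (Fin n) ℚ) (MvPolynomial (Fin n) ℚ))⁆ = 0 := by
    refine derivation_ext fun l => ?_
    rw [Derivation.commutator_apply]
    simp [pderiv_X, Pi.single_apply, apply_ite]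
  refine LinearMap.ext fun f => ?_
  have := congrArg (fun d => d f) h
  simp only [Derivation.commutator_apply, Derivation.coe_zero, Pi.zero_apply] at this
  simpa [sub_eq_zero] using this

/-- The constant coefficient differential operator `∂(f)` on polynomials. -/
noncomputable def polyDiff : MvPolynomial (Fin n) ℚ →ₐ[ℚ]
    Module.End ℚ (MvPolynomial (Fin n) ℚ) :=
  evalOp (fun i => (pderiv i).toLinearMap) pderiv_mul_comm

@[simp] lemma polyDiff_X (i : Fin n) (p : MvPolynomial (Fin n) ℚ) :
    polyDiff (X i) p = pderiv i p := by
  simp [polyDiff]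

lemma polyDiff_mul (f g p : MvPolynomial (Fin n) ℚ) :
    polyDiff (f * g) p = polyDiff f (polyDiff g p) := by
  rw [map_mul]; rfl

lemma polyDiff_comm (f g p : MvPolynomial (Fin n) ℚ) :
    polyDiff f (polyDiff g p) = polyDiff g (polyDiff f p) := by
  rw [← polyDiff_mul, mul_comm, polyDiff_mul]

lemma polyDiff_C (c : ℚ) (p : MvPolynomial (Fin n) ℚ) : polyDiff (C c) p = c • p := by
  rw [← algebraMap_eq, AlgHom.commutes]; rfl

lemma rename_polyDiff (w : Equiv.Perm (Fin n)) (f p : MvPolynomial (Fin n) ℚ) :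
    rename w (polyDiff f p) = polyDiff (rename w f) (rename w p) := by
  induction f using MvPolynomial.induction_on generalizing p with
  | C a => simp
  | add f g hf hg => simp [hf, hg]
  | mul_X f i hf =>
    rw [polyDiff_mul, hf, map_mul, polyDiff_mul, polyDiff_X, rename_X, polyDiff_X,
      pderiv_rename w.injective]

/-- A differential operator of order `i` lowers degrees by `i`. -/
lemma polyDiff_isHomogeneous {f p : MvPolynomial (Fin n) ℚ} {i d : ℕ}
    (hf : f.IsHomogeneous i) (hp : p.IsHomogeneous d) :
    (polyDiff f p).IsHomogeneous (d - i) ∧ (d < i → polyDiff f p = 0) := by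
  have key : ∀ (m : Fin n →₀ ℕ) (p : MvPolynomial (Fin n) ℚ) (d : ℕ), p.IsHomogeneous d →
      (polyDiff (monomial m 1) p).IsHomogeneous (d - m.degree) ∧
        (d < m.degree → polyDiff (monomial m 1) p = 0) := by
    intro m
    induction m using Finsupp.induction_linear with
    | zero =>
      intro p d hp
      have h1 : (monomial (0 : Fin n →₀ ℕ) (1 : ℚ)) = 1 := rfl
      simpa [h1] using hp
    | add m₁ m₂ h₁ h₂ =>
      intro p d hp
      have e : monomial (m₁ + m₂) (1 : ℚ) = monomial m₁ 1 * monomial m₂ 1 := by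
        simp [monomial_mul]
      obtain ⟨a, a'⟩ := h₂ p d hp
      obtain ⟨b, b'⟩ := h₁ _ _ a
      rw [e, polyDiff_mul, map_add]
      refine ⟨by rwa [Nat.sub_sub, add_comm] at b, fun hd => ?_⟩
      by_cases hd' : d < m₂.degree
      · rw [a' hd', map_zero]
      · exact b' (by omega)
    | single j a =>
      simp only [Finsupp.degree_single, ← X_pow_eq_monomial]
      induction a with
      | zero => intro p d hp; simpa using hp
      | succ a ih =>
        intro p d hp
        rw [pow_succ, polyDiff_mul, polyDiff_X]
        obtain ⟨b, b'⟩ := ih _ _ hp.pderiv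
        refine ⟨by rwa [Nat.sub_sub, add_comm 1] at b, fun hd => ?_⟩
        rcases Nat.eq_zero_or_pos d with rfl | h0
        · rw [← totalDegree_zero_iff_isHomogeneous, totalDegree_eq_zero_iff_eq_C] at hp
          rw [hp, pderiv_C, map_zero]
        · exact b' (by omega)
  have hs : polyDiff f p = ∑ m ∈ f.support, f.coeff m • polyDiff (monomial m 1) p := by
    conv_lhs => rw [f.as_sum, map_sum, LinearMap.sum_apply]
    refine Finset.sum_congr rfl fun m _ => ?_
    rw [← LinearMap.smul_apply, ← map_smul, smul_monomial, smul_eq_mul, mul_one]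
  have hdeg : ∀ m ∈ f.support, m.degree = i := fun m hm => by
    rw [Finsupp.degree_eq_weight_one]
    exact hf (mem_support_iff.1 hm)
  constructor
  · rw [hs]
    refine IsHomogeneous.sum _ _ _ fun m hm => ?_
    have := (key m p d hp).1
    rw [hdeg m hm] at this
    exact Submodule.smul_mem (homogeneousSubmodule (Fin n) ℚ _) _ this
  · intro hd
    rw [hs]
    refine Finset.sum_eq_zero fun m hm => ?_
    rw [(key m p d hp).2 (by rwa [hdeg m hm]), smul_zero]

/-- On `x_i ^ b * q` with `q` free of `x_i`, the operator `∂_i ^ a` acts by a falling factorial. -/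
lemma polyDiff_X_pow (i : Fin n) (a b : ℕ) {q : MvPolynomial (Fin n) ℚ}
    (hq : pderiv i q = 0) :
    polyDiff (X i ^ a) (X i ^ b * q) = (b.descFactorial a : ℚ) • (X i ^ (b - a) * q) := by
  induction a with
  | zero => simp
  | succ a ih =>
    rw [pow_succ', polyDiff_mul, ih, map_smul, polyDiff_X, pderiv_mul, hq, pderiv_pow,
      pderiv_X_self, mul_zero, add_zero, mul_one, Nat.descFactorial_succ, ← Nat.sub_sub, mul_assoc,
      ← map_natCast (C (σ := Fin n) (R := ℚ)), C_mul', smul_smul, mul_comm]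
    push_cast
    ring_nf

end PolyDiff

/-! ### Alternants -/

section Alternant

variable {n k : ℕ}

/-- The alternant `det (x_{e a} ^ {c i})`. -/
noncomputable def altDet (c : Fin k → ℕ) (e : Fin k → Fin n) : MvPolynomial (Fin n) ℚ :=
  Matrix.det (Matrix.of fun a i => X (e a) ^ c i)

/-- The Vandermonde determinant in the variables `x_{e 0}, …, x_{e (k - 1)}`, with the exponents
`k - 1, …, 1, 0` in this order. -/
noncomputable def vand (e : Fin k → Fin n) : MvPolynomial (Fin n) ℚ :=
  altDet (fun i => (i.rev : ℕ)) e

lemma altDet_eq_sum (c : Fin k → ℕ) (e : Fin k → Fin n) :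
    altDet c e = ∑ w : Equiv.Perm (Fin k),
      ((Equiv.Perm.sign w : ℤ) : ℚ) • ∏ i, X (e (w i)) ^ c i := by
  rw [altDet, Matrix.det_apply']
  refine Finset.sum_congr rfl fun w _ => ?_
  rw [smul_eq_C_mul]
  simp

lemma pderiv_prod_X_pow_of_ne {ι : Type*} (s : Finset ι) (u : ι → Fin n) (c : ι → ℕ) {j : Fin n}
    (hj : ∀ i, u i ≠ j) : pderiv j (∏ i ∈ s, X (u i) ^ c i : MvPolynomial (Fin n) ℚ) = 0 := by
  refine Finset.prod_induction _ (fun p => pderiv j p = 0) (fun p q hp hq => ?_) pderiv_one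
    fun i _ => ?_
  · simp only [pderiv_mul, hp, hq, zero_mul, mul_zero, add_zero]
  · rw [pderiv_pow, pderiv_X_of_ne (hj i), mul_zero]

lemma pderiv_altDet_of_notMem (c : Fin k → ℕ) (e : Fin k → Fin n) {j : Fin n}
    (hj : ∀ a, e a ≠ j) : pderiv j (altDet c e) = 0 := by
  rw [altDet_eq_sum, map_sum]
  exact Finset.sum_eq_zero fun w _ => by
    rw [Derivation.map_smul, pderiv_prod_X_pow_of_ne _ _ _ fun i => hj (w i), smul_zero]

lemma rename_altDet (c : Fin k → ℕ) (e : Fin k → Fin n) (w : Fin n → Fin n) :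
    rename w (altDet c e) = altDet c (w ∘ e) := by
  simp [altDet_eq_sum, map_sum, map_prod]

lemma altDet_comp_swap (c : Fin k → ℕ) (e : Fin k → Fin n) {i j : Fin k} (hij : i ≠ j) :
    altDet c (e ∘ Equiv.swap i j) = -altDet c e := by
  have := Matrix.det_permute (Equiv.swap i j)
    (Matrix.of fun a i => (X (e a) : MvPolynomial (Fin n) ℚ) ^ c i)
  rw [Equiv.Perm.sign_swap hij] at this
  simpa [altDet, Matrix.submatrix] using this

lemma vand_isHomogeneous (e : Fin k → Fin n) : (vand e).IsHomogeneous (k.choose 2) := by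
  rw [vand, altDet_eq_sum]
  refine IsHomogeneous.sum _ _ _ fun w _ => ?_
  have h : k.choose 2 = ∑ i : Fin k, (i.rev : ℕ) := by
    rw [← Equiv.sum_comp Fin.revPerm (fun i : Fin k => (i.rev : ℕ))]
    simp only [Fin.revPerm_apply, Fin.rev_rev, Fin.sum_univ_eq_sum_range (fun i => i),
      Finset.sum_range_id, Nat.choose_two_right]
  rw [h]
  refine Submodule.smul_mem (homogeneousSubmodule (Fin n) ℚ _) _ ?_
  exact IsHomogeneous.prod _ _ _ fun i _ => by
    simpa using (isHomogeneous_X ℚ (e (w i))).pow (i.rev : ℕ)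

/-- The top derivative of a Vandermonde determinant in one of its variables is, up to a nonzero
constant, the Vandermonde determinant in the others. -/
lemma polyDiff_vand_cons {m : Fin n} {e : Fin k → Fin n} (hm : ∀ a, e a ≠ m) :
    polyDiff (X m ^ k) (vand (Fin.cons m e : Fin (k + 1) → Fin n)) = (k.factorial : ℚ) • vand e := by
  have hexp : vand (Fin.cons m e : Fin (k + 1) → Fin n) =
      ∑ j : Fin (k + 1), (-1 : ℚ) ^ (j : ℕ) •
        (X m ^ (j.rev : ℕ) * altDet (fun i => ((j.succAbove i).rev : ℕ)) e) := by
    rw [vand, altDet, Matrix.det_succ_row_zero]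
    refine Finset.sum_congr rfl fun j _ => ?_
    rw [smul_eq_C_mul, mul_assoc]
    congr 1
    simp
  rw [hexp, map_sum, Finset.sum_eq_single 0]
  · rw [map_smul, polyDiff_X_pow _ _ _ (pderiv_altDet_of_notMem _ _ hm)]
    simp [Nat.descFactorial_self, vand]
  · intro j _ hj
    have : (j.rev : ℕ) < k := by
      have := Fin.pos_iff_ne_zero.2 hj
      rw [Fin.val_rev]; simp only [Fin.lt_def] at this; simp at this; omega
    rw [map_smul, polyDiff_X_pow _ _ _ (pderiv_altDet_of_notMem _ _ hm),
      Nat.descFactorial_eq_zero_iff_lt.2 this]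
    simp
  · simp

lemma choose_two_le_sum_of_injective {f : Fin k → ℕ} (hf : Function.Injective f) :
    k.choose 2 ≤ ∑ i, f i := by
  induction k with
  | zero => simp
  | succ k ih =>
    obtain ⟨i, hi⟩ : ∃ i, k ≤ f i := by
      by_contra! hlt
      have := Fintype.card_le_of_injective (fun i => (⟨f i, hlt i⟩ : Fin k))
        fun a b hab => hf (by simpa using hab)
      simp at this
    rw [Fin.sum_univ_succAbove _ i]
    have := ih (hf.comp (Fin.succAbove_right_injective (p := i)))
    have h2 : (k + 1).choose 2 = k + k.choose 2 := by
      rw [Nat.choose_succ_succ' k 1, Nat.choose_one_right]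
    simp only [Function.comp_apply] at this
    omega

/-- A polynomial in `k` variables that is alternating and of degree less than `k choose 2`
vanishes: each of its monomials has a repeated exponent. -/
lemma eq_zero_of_alternating {g : MvPolynomial (Fin n) ℚ} {e : Fin k → Fin n}
    (he : Function.Injective e) {d : ℕ} (hd : d < k.choose 2) (hg : g.IsHomogeneous d)
    (hvar : ∀ j, (∀ a, e a ≠ j) → pderiv j g = 0)
    (halt : ∀ i j, i ≠ j → rename (Equiv.swap (e i) (e j)) g = -g) : g = 0 := by
  by_contra hne
  obtain ⟨m, hm⟩ := exists_coeff_ne_zero hne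
  have hdeg : m.degree = d := by
    rw [Finsupp.degree_eq_weight_one]
    exact hg hm
  have hout : ∀ j, (∀ a, e a ≠ j) → m j = 0 := by
    intro j hj
    by_contra h0
    have h1 : coeff (m - Finsupp.single j 1) (pderiv j g) = 0 := by rw [hvar j hj, coeff_zero]
    have h2 : m - Finsupp.single j 1 + Finsupp.single j 1 = m :=
      tsub_add_cancel_of_le (by simpa using Nat.one_le_iff_ne_zero.2 h0)
    rw [coeff_pderiv, h2] at h1
    exact (mul_ne_zero hm (by positivity)) h1
  have hinj : Function.Injective (m ∘ e) := by
    intro i j hij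
    by_contra hne
    have h1 : Finsupp.mapDomain (Equiv.swap (e i) (e j)) m = m := by
      ext a
      rw [← Finsupp.equivMapDomain_eq_mapDomain, Finsupp.equivMapDomain_apply, Equiv.symm_swap]
      simp only [Function.comp_apply] at hij
      rcases eq_or_ne a (e i) with rfl | ha
      · simp [hij]
      rcases eq_or_ne a (e j) with rfl | hb
      · simp [hij]
      rw [Equiv.swap_apply_of_ne_of_ne ha hb]
    have h2 := coeff_rename_mapDomain _ (Equiv.swap (e i) (e j)).injective g m
    rw [h1, halt i j hne, coeff_neg] at h2
    exact hm (by linarith)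
  have hsum : ∑ i, (m ∘ e) i = m.degree := by
    rw [Finsupp.degree_eq_sum]
    simp only [Function.comp_apply]
    refine (Finset.sum_map Finset.univ ⟨e, he⟩ m).symm.trans ?_
    refine Finset.sum_subset (Finset.subset_univ _) fun j _ hj => hout j fun a ha => hj ?_
    simp [← ha]
  have := choose_two_le_sum_of_injective hinj
  omega

end Alternant

/-! ### Hook ideals and annihilators of Vandermonde determinants -/

section HookIdeal

variable {n k : ℕ}

/-- The ideal generated by the `e_d(S)` with `d ≥ 1`, the squarefree monomials of degree `k` in
the variables indexed by `S`, and the variables outside `S`.  For `S` the set of all indices this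
is the Tanisaki ideal of the hook `(n - k + 1, 1, …, 1)`. -/
noncomputable def hookIdeal (S : Finset (Fin n)) (k : ℕ) : Ideal (MvPolynomial (Fin n) ℚ) :=
  Ideal.span ({f | ∃ d, f = esymmOn S (d + 1)} ∪
    {f | ∃ T ⊆ S, T.card = k ∧ f = ∏ i ∈ T, X i} ∪ {f | ∃ i ∉ S, f = X i})

lemma esymmOn_mem_hookIdeal (S : Finset (Fin n)) (k d : ℕ) :
    esymmOn S (d + 1) ∈ hookIdeal S k :=
  Ideal.subset_span (Or.inl (Or.inl ⟨d, rfl⟩))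

lemma prod_X_mem_hookIdeal {S T : Finset (Fin n)} (hT : T ⊆ S) (hk : T.card = k) :
    ∏ i ∈ T, X i ∈ hookIdeal S k :=
  Ideal.subset_span (Or.inl (Or.inr ⟨T, hT, hk, rfl⟩))

lemma X_mem_hookIdeal {S : Finset (Fin n)} {i : Fin n} (hi : i ∉ S) : X i ∈ hookIdeal S k :=
  Ideal.subset_span (Or.inr ⟨i, hi, rfl⟩)

lemma hookIdeal_le {S : Finset (Fin n)} {J : Ideal (MvPolynomial (Fin n) ℚ)}
    (h₁ : ∀ d, esymmOn S (d + 1) ∈ J) (h₂ : ∀ T ⊆ S, T.card = k → ∏ i ∈ T, X i ∈ J)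
    (h₃ : ∀ i ∉ S, X i ∈ J) : hookIdeal S k ≤ J := by
  refine Ideal.span_le.2 ?_
  rintro f ((⟨d, rfl⟩ | ⟨T, hT, hk, rfl⟩) | ⟨i, hi, rfl⟩)
  exacts [h₁ d, h₂ T hT hk, h₃ i hi]

@[simp] lemma esymmOn_zero (S : Finset (Fin n)) : esymmOn S 0 = 1 := by simp [esymmOn]

lemma esymmOn_isHomogeneous (S : Finset (Fin n)) (d : ℕ) : (esymmOn S d).IsHomogeneous d := by
  refine IsHomogeneous.sum _ _ _ fun T hT => ?_
  have := IsHomogeneous.prod T (fun i => (X i : MvPolynomial (Fin n) ℚ)) (fun _ => 1)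
    fun i _ => isHomogeneous_X ℚ i
  simpa [(Finset.mem_powersetCard.1 hT).2] using this

lemma esymmOn_insert {S : Finset (Fin n)} {m : Fin n} (hm : m ∉ S) (d : ℕ) :
    esymmOn (insert m S) (d + 1) = esymmOn S (d + 1) + X m * esymmOn S d := by
  have hmem : ∀ T ∈ S.powersetCard d, m ∉ T := fun T hT h =>
    hm ((Finset.mem_powersetCard.1 hT).1 h)
  unfold esymmOn
  rw [Finset.powersetCard_succ_insert hm, Finset.sum_union, Finset.sum_image, Finset.mul_sum]
  · congr 1
    exact Finset.sum_congr rfl fun T hT => Finset.prod_insert (hmem T hT)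
  · intro T hT T' hT' h
    rw [← Finset.erase_insert (hmem T hT), ← Finset.erase_insert (hmem T' hT'), h]
  · rw [Finset.disjoint_left]
    intro T hT hT'
    obtain ⟨U, -, rfl⟩ := Finset.mem_image.1 hT'
    exact hm ((Finset.mem_powersetCard.1 hT).1 (Finset.mem_insert_self _ _))

/-- Modulo the hook ideal, `e_d` of all variables but `x_m` is `± x_m ^ d`; as `x_m` times a
squarefree monomial of degree `k - 1` in the other variables lies in the ideal, so does
`x_m ^ k`. -/
lemma X_pow_mem_hookIdeal {S : Finset (Fin n)} {m : Fin n} (hm : m ∉ S) (k : ℕ) :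
    X m ^ (k + 1) ∈ hookIdeal (insert m S) (k + 1) := by
  set I := hookIdeal (insert m S) (k + 1)
  have h₁ : ∀ d, esymmOn S d - (-X m) ^ d ∈ I := by
    intro d
    induction d with
    | zero => simp
    | succ d ih =>
      have : esymmOn S (d + 1) - (-X m) ^ (d + 1) =
          esymmOn (insert m S) (d + 1) - X m * (esymmOn S d - (-X m) ^ d) := by
        rw [esymmOn_insert hm]; ring
      rw [this]
      exact sub_mem (esymmOn_mem_hookIdeal _ _ _) (I.mul_mem_left _ ih)
  have h₂ : X m * esymmOn S k ∈ I := by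
    unfold esymmOn
    rw [Finset.mul_sum]
    refine sum_mem fun T hT => ?_
    rw [Finset.mem_powersetCard] at hT
    have hmT : m ∉ T := fun h => hm (hT.1 h)
    rw [← Finset.prod_insert hmT]
    exact prod_X_mem_hookIdeal (Finset.insert_subset_insert _ hT.1)
      (by rw [Finset.card_insert_of_notMem hmT, hT.2])
  have h₃ : X m ^ (k + 1) =
      (-1) ^ k * (X m * esymmOn S k - X m * (esymmOn S k - (-X m) ^ k)) := by
    have : ((-1 : MvPolynomial (Fin n) ℚ) ^ k) * (-1) ^ k = 1 := by rw [← mul_pow]; simp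
    rw [neg_pow (X m : MvPolynomial (Fin n) ℚ) k]
    linear_combination -(X m ^ (k + 1)) * this
  rw [h₃]
  exact I.mul_mem_left _ (sub_mem h₂ (I.mul_mem_left _ (h₁ k)))

/-- The ideal of all `f` such that `∂(f)` annihilates every Vandermonde determinant in `k` of the
variables indexed by `S`. -/
noncomputable def annIdeal (S : Finset (Fin n)) (k : ℕ) : Ideal (MvPolynomial (Fin n) ℚ) where
  carrier := {f | ∀ e : Fin k → Fin n, Function.Injective e → (∀ a, e a ∈ S) →
    polyDiff f (vand e) = 0}
  add_mem' := fun {f g} hf hg e he heS => by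
    rw [map_add, LinearMap.add_apply, hf e he heS, hg e he heS, add_zero]
  zero_mem' := fun e _ _ => by simp
  smul_mem' := fun g f hf e he heS => by
    rw [smul_eq_mul, polyDiff_mul, hf e he heS, map_zero]

lemma mem_annIdeal {S : Finset (Fin n)} {f : MvPolynomial (Fin n) ℚ} :
    f ∈ annIdeal S k ↔ ∀ e : Fin k → Fin n, Function.Injective e → (∀ a, e a ∈ S) →
      polyDiff f (vand e) = 0 := Iff.rfl

lemma polyDiff_prod_X_of_mem {T : Finset (Fin n)} {j : Fin n} (hj : j ∈ T)
    {p : MvPolynomial (Fin n) ℚ} (hp : pderiv j p = 0) : polyDiff (∏ i ∈ T, X i) p = 0 := by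
  rw [← Finset.prod_erase_mul T _ hj, polyDiff_mul, polyDiff_X, hp, map_zero]

lemma hookIdeal_le_annIdeal (S : Finset (Fin n)) (hk : 0 < k) :
    hookIdeal S k ≤ annIdeal S k := by
  refine hookIdeal_le (fun d e he heS => ?_) (fun T hT hTk e he heS => ?_) fun i hi e he heS => ?_
  · obtain ⟨h₁, h₂⟩ := polyDiff_isHomogeneous (esymmOn_isHomogeneous S (d + 1))
      (vand_isHomogeneous e)
    by_cases hd : k.choose 2 < d + 1
    · exact h₂ hd
    refine eq_zero_of_alternating he (by omega) h₁ (fun j hj => ?_) fun i j hij => ?_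
    · rw [← polyDiff_X, polyDiff_comm, polyDiff_X, vand, pderiv_altDet_of_notMem _ _ hj, map_zero]
    · have hS : S.map (Equiv.swap (e i) (e j)).toEmbedding = S := by
        rw [Finset.map_eq_image]
        refine Finset.eq_of_subset_of_card_le (fun x hx => ?_)
          (Finset.card_image_of_injective _ (Equiv.injective _)).ge
        obtain ⟨y, hy, rfl⟩ := Finset.mem_image.1 hx
        by_cases h1 : y = e i
        · simpa [h1] using heS j
        by_cases h2 : y = e j
        · simpa [h2] using heS i
        simpa [Equiv.swap_apply_of_ne_of_ne h1 h2] using hy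
      have hv : ⇑(Equiv.swap (e i) (e j)) ∘ e = e ∘ Equiv.swap i j := by
        ext1 a
        exact (he.swap_apply i j a)
      rw [rename_polyDiff, rename_esymmOn, hS, vand, rename_altDet, hv, altDet_comp_swap _ _ hij,
        map_neg]
  · -- every term of the determinant involves only `k - 1` variables, hence misses one of `T`
    rw [vand, altDet_eq_sum, map_sum]
    refine Finset.sum_eq_zero fun w _ => ?_
    rw [map_smul]
    obtain ⟨k, rfl⟩ : ∃ l, k = l + 1 := ⟨k - 1, by omega⟩
    obtain ⟨j, hjT, hj⟩ : ∃ j ∈ T, ∀ i : Fin k, e (w i.castSucc) ≠ j := by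
      by_contra! hcon
      have : T.card ≤ (Finset.univ.image fun i : Fin k => e (w i.castSucc)).card :=
        Finset.card_le_card fun j hj => by simpa using hcon j hj
      have := this.trans Finset.card_image_le
      simp at this
      omega
    rw [polyDiff_prod_X_of_mem hjT, smul_zero]
    rw [Fin.prod_univ_castSucc]
    simp only [Fin.rev_last, Fin.val_zero, pow_zero, mul_one]
    exact pderiv_prod_X_pow_of_ne _ _ _ hj
  · rw [polyDiff_X, vand, pderiv_altDet_of_notMem]
    rintro a rfl
    exact hi (heS a)

lemma annIdeal_one_le (S : Finset (Fin n)) (hS : S.Nonempty) : annIdeal S 1 ≤ hookIdeal S 1 := by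
  have hX : ∀ i, X i ∈ hookIdeal S 1 := fun i => by
    by_cases hi : i ∈ S
    · simpa using prod_X_mem_hookIdeal (k := 1) (Finset.singleton_subset_iff.2 hi) (by simp)
    · exact X_mem_hookIdeal hi
  have hC : ∀ f : MvPolynomial (Fin n) ℚ, ∃ c, f - C c ∈ hookIdeal S 1 := by
    intro f
    induction f using MvPolynomial.induction_on with
    | C a => exact ⟨a, by simp⟩
    | add f g hf hg =>
      obtain ⟨a, ha⟩ := hf
      obtain ⟨b, hb⟩ := hg
      refine ⟨a + b, ?_⟩
      convert add_mem ha hb using 1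
      rw [C_add]; ring
    | mul_X f i _ => exact ⟨0, by simpa using Ideal.mul_mem_left _ _ (hX i)⟩
  intro f hf
  obtain ⟨c, hc⟩ := hC f
  have h1 : C c ∈ annIdeal S 1 := by
    have := sub_mem hf (hookIdeal_le_annIdeal S one_pos hc)
    rwa [sub_sub_cancel] at this
  obtain ⟨s, hs⟩ := hS
  have h2 := h1 (fun _ => s) (Function.injective_of_subsingleton _) fun _ => hs
  have h3 : vand (fun _ : Fin 1 => s) = 1 := by simp [vand, altDet]
  rw [polyDiff_C, h3, smul_eq_zero] at h2
  rcases h2 with rfl | h2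
  · simpa using hc
  · exact absurd h2 one_ne_zero

/-- The inductive step on the number of variables: if `x_m ^ j * g` kills all Vandermonde
determinants in `k + 1` variables, then `g` kills those in `k` variables other than `x_m`. -/
lemma mem_annIdeal_of_X_pow_mul_mem {S : Finset (Fin n)} {m : Fin n} (hm : m ∉ S) {j : ℕ}
    (hj : j ≤ k) {g : MvPolynomial (Fin n) ℚ}
    (hg : X m ^ j * g ∈ annIdeal (insert m S) (k + 1)) : g ∈ annIdeal S k := by
  intro e he heS
  have hme : ∀ a, e a ≠ m := fun a h => hm (h ▸ heS a)
  have h₁ := hg (Fin.cons m e) (Fin.cons_injective_iff.2 ⟨by simpa using hme, he⟩) fun a => by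
    refine Fin.cases (by simp) (fun a => ?_) a
    simpa using Or.inr (heS a)
  have h₂ : polyDiff (g * X m ^ k) (vand (Fin.cons m e : Fin (k + 1) → Fin n)) = 0 := by
    have : g * X m ^ k = X m ^ (k - j) * (X m ^ j * g) := by
      rw [← mul_assoc, ← pow_add, Nat.sub_add_cancel hj, mul_comm]
    rw [this, polyDiff_mul, h₁, map_zero]
  rw [polyDiff_mul, polyDiff_vand_cons hme, map_smul, smul_eq_zero] at h₂
  exact h₂.resolve_left (by exact_mod_cast k.factorial_ne_zero)

/-- `x_m ^ j` times the hook ideal in one variable and one degree less lies in the hook ideal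
modulo `x_m ^ (j + 1)`. -/
lemma X_pow_mul_mem {S : Finset (Fin n)} {m : Fin n} (hm : m ∉ S) {j : ℕ} (hk : 0 < k)
    (hj : 0 < j ∨ k = S.card) {g : MvPolynomial (Fin n) ℚ} (hg : g ∈ hookIdeal S k) :
    X m ^ j * g ∈ hookIdeal (insert m S) (k + 1) ⊔ Ideal.span {X m ^ (j + 1)} := by
  set J := hookIdeal (insert m S) (k + 1) ⊔ Ideal.span {X m ^ (j + 1)} with hJ
  have hI : ∀ {f}, f ∈ hookIdeal (insert m S) (k + 1) → f ∈ J := fun h =>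
    Ideal.mem_sup_left h
  have hp : ∀ f, X m ^ (j + 1) * f ∈ J := fun f =>
    J.mul_mem_right _ (Ideal.mem_sup_right (Ideal.mem_span_singleton_self _))
  have he : ∀ d, X m ^ j * esymmOn S (d + 1) ∈ J := fun d => by
    have : X m ^ j * esymmOn S (d + 1) =
        X m ^ j * esymmOn (insert m S) (d + 1) - X m ^ (j + 1) * esymmOn S d := by
      rw [esymmOn_insert hm]; ring
    rw [this]
    exact sub_mem (J.mul_mem_left _ (hI (esymmOn_mem_hookIdeal _ _ _))) (hp _)
  suffices h : hookIdeal S k ≤ Submodule.comap (LinearMap.mulLeft _ (X m ^ j)) J from h hg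
  refine hookIdeal_le he (fun T hT hTk => ?_) fun i hi => ?_
  · simp only [Submodule.mem_comap, LinearMap.mulLeft_apply]
    rcases hj with hj | hj
    · have hmT : m ∉ T := fun h => hm (hT h)
      obtain ⟨j, rfl⟩ : ∃ l, j = l + 1 := ⟨j - 1, by omega⟩
      rw [pow_succ, mul_assoc, ← Finset.prod_insert hmT]
      exact J.mul_mem_left _ (hI (prod_X_mem_hookIdeal (Finset.insert_subset_insert _ hT)
        (by rw [Finset.card_insert_of_notMem hmT, hTk])))
    · obtain rfl : T = S := Finset.eq_of_subset_of_card_le hT (by omega)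
      obtain ⟨k, rfl⟩ : ∃ l, k = l + 1 := ⟨k - 1, by omega⟩
      have := he k
      rwa [hj, esymmOn, Finset.powersetCard_self, Finset.sum_singleton] at this
  · simp only [Submodule.mem_comap, LinearMap.mulLeft_apply]
    by_cases him : i = m
    · rw [him, ← pow_succ, ← mul_one (X m ^ (j + 1))]
      exact hp 1
    · exact J.mul_mem_left _ (hI (X_mem_hookIdeal (by simp [him, hi])))

lemma annIdeal_le_hookIdeal (S : Finset (Fin n)) :
    ∀ k, 0 < k → k ≤ S.card → annIdeal S k ≤ hookIdeal S k := by
  induction S using Finset.induction_on with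
  | empty =>
    intro k hk hkS
    simp at hkS
    omega
  | insert m S hm ih =>
    intro k hk hkS
    obtain ⟨k, rfl⟩ : ∃ l, k = l + 1 := ⟨k - 1, by omega⟩
    rcases Nat.eq_zero_or_pos k with rfl | hk
    · exact annIdeal_one_le _ (Finset.insert_nonempty _ _)
    rw [Finset.card_insert_of_notMem hm] at hkS
    intro f hf
    have hI : hookIdeal (insert m S) (k + 1) ≤ annIdeal (insert m S) (k + 1) :=
      hookIdeal_le_annIdeal _ k.succ_pos
    -- `f` can be pushed into higher and higher powers of `x_m` modulo the hook ideal
    have key : ∀ j ≤ k + 1, f ∈ hookIdeal (insert m S) (k + 1) ⊔ Ideal.span {X m ^ j} := by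
      intro j hj
      induction j with
      | zero => simp
      | succ j ihj =>
        by_cases hlow : j = 0 ∧ k + 1 ≤ S.card
        · obtain ⟨rfl, hkS⟩ := hlow
          have hfS : f ∈ hookIdeal S (k + 1) := ih (k + 1) (by omega) hkS
            fun e he heS => hf e he fun a => Finset.mem_insert_of_mem (heS a)
          refine hookIdeal_le (fun d => ?_) (fun T hT hTk => ?_) (fun i hi => ?_) hfS
          · rw [eq_sub_of_add_eq (esymmOn_insert hm d).symm]
            exact sub_mem (Ideal.mem_sup_left (esymmOn_mem_hookIdeal _ _ _))
              (Ideal.mem_sup_right (Ideal.mul_mem_right _ _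
                (by simp)))
          · exact Ideal.mem_sup_left
              (prod_X_mem_hookIdeal (hT.trans (Finset.subset_insert _ _)) hTk)
          · by_cases him : i = m
            · exact Ideal.mem_sup_right (by simp [him])
            · exact Ideal.mem_sup_left (X_mem_hookIdeal (by simp [him, hi]))
        · obtain ⟨a, ha, b, hb, rfl⟩ := Submodule.mem_sup.1 (ihj (by omega))
          obtain ⟨g, rfl⟩ := Ideal.mem_span_singleton.1 hb
          have hg : g ∈ hookIdeal S k := by
            refine ih k hk (by omega) (mem_annIdeal_of_X_pow_mul_mem hm (j := j) (by omega) ?_)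
            have := sub_mem hf (hI ha)
            rwa [add_sub_cancel_left] at this
          exact add_mem (Ideal.mem_sup_left ha) (X_pow_mul_mem hm hk (by omega) hg)
    have h₁ := key (k + 1) le_rfl
    rwa [sup_eq_left.2] at h₁
    rw [Ideal.span_le, Set.singleton_subset_iff]
    exact X_pow_mem_hookIdeal hm k

/-- Some differential operator of the top order does not annihilate a given Vandermonde determinant. -/
lemma exists_polyDiff_vand_ne_zero {e : Fin k → Fin n} (he : Function.Injective e) :
    ∃ f : MvPolynomial (Fin n) ℚ, f.IsHomogeneous (k.choose 2) ∧ polyDiff f (vand e) ≠ 0 := by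
  induction k with
  | zero => exact ⟨1, isHomogeneous_one _ _, by simp [vand, altDet]⟩
  | succ k ih =>
    obtain ⟨f, hf, hfv⟩ := ih (he.comp (Fin.succ_injective k))
    refine ⟨f * X (e 0) ^ k, ?_, ?_⟩
    · have h2 : (k + 1).choose 2 = k.choose 2 + 1 * k := by
        rw [Nat.choose_succ_succ' k 1, Nat.choose_one_right]
        ring
      exact h2 ▸ hf.mul ((isHomogeneous_X ℚ (e 0)).pow k)
    · have h := polyDiff_vand_cons (m := e 0) (e := e ∘ Fin.succ)
        fun a h => Fin.succ_ne_zero a (he h)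
      rw [show (Fin.cons (e 0) (e ∘ Fin.succ) : Fin (k + 1) → Fin n) = e from
        Fin.cons_self_tail e] at h
      rw [polyDiff_mul, h, map_smul]
      exact smul_ne_zero (by exact_mod_cast k.factorial_ne_zero) hfv

end HookIdeal

/-! ### The Tanisaki ideal of a hook -/

section Tanisaki

variable {n r : ℕ} (h : r < n)

lemma conjPart_hook (j : ℕ) :
    conjPart (hook h) j = (if j ≤ r + 1 then 1 else 0) + if j ≤ 1 then n - r - 1 else 0 := by
  have h2 : (Multiset.filter (fun p => j ≤ p) (Multiset.replicate (n - r - 1) 1)).card =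
      if j ≤ 1 then n - r - 1 else 0 := by
    split_ifs with hj
    · rw [Multiset.filter_eq_self.2 fun a ha => by rwa [Multiset.eq_of_mem_replicate ha],
        Multiset.card_replicate]
    · rw [Multiset.filter_eq_nil.2 fun a ha => by rwa [Multiset.eq_of_mem_replicate ha],
        Multiset.card_zero]
  simp only [conjPart, hook]
  split_ifs with hj <;> simp_all [Multiset.filter_cons_of_pos, Multiset.filter_cons_of_neg, add_comm]

lemma sum_conjPart_hook_of_two_le {a : ℕ} (ha : 2 ≤ a) :
    ∑ j ∈ Finset.Icc a n, conjPart (hook h) j = r + 2 - a := by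
  have h1 : ∀ j ∈ Finset.Icc a n, conjPart (hook h) j = if j ≤ r + 1 then 1 else 0 := by
    intro j hj
    rw [Finset.mem_Icc] at hj
    rw [conjPart_hook, if_neg (show ¬ j ≤ 1 by omega), add_zero]
  rw [Finset.sum_congr rfl h1, ← Finset.sum_filter, Finset.sum_const, smul_eq_mul, mul_one]
  have h2 : (Finset.Icc a n).filter (fun j => j ≤ r + 1) = Finset.Icc a (r + 1) := by
    ext j
    simp only [Finset.mem_filter, Finset.mem_Icc]
    omega
  rw [h2, Nat.card_Icc]

lemma sum_conjPart_hook : ∑ j ∈ Finset.Icc 1 n, conjPart (hook h) j = n := by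
  rw [← Finset.add_sum_Ioc_eq_sum_Icc (by omega : 1 ≤ n)]
  have : Finset.Ioc 1 n = Finset.Icc 2 n := rfl
  rw [this, sum_conjPart_hook_of_two_le h le_rfl, conjPart_hook]
  simp
  omega

/-- For a hook, only the full set of variables and the squarefree monomials of degree `n - r`
contribute to the Tanisaki ideal: the other generators are sums of squarefree monomials of degree
at least `n - r`. -/
lemma tanisakiIdeal_hook : tanisakiIdeal (hook h) = hookIdeal Finset.univ (n - r) := by
  refine le_antisymm (Ideal.span_le.2 ?_) (hookIdeal_le (fun d => ?_) (fun T _ hT => ?_) (by simp))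
  · rintro _ ⟨S, d, hS, hd, rfl⟩
    have hSn : S.card ≤ n := by simpa using S.card_le_univ
    rcases hSn.eq_or_lt with hS' | hS'
    · obtain rfl : S = Finset.univ := (Finset.card_eq_iff_eq_univ S).1 (by simpa using hS')
      rw [hS', Nat.sub_self, zero_add, sum_conjPart_hook] at hd
      obtain ⟨d, rfl⟩ : ∃ l, d = l + 1 := ⟨d - 1, by omega⟩
      exact esymmOn_mem_hookIdeal _ _ _
    · rw [sum_conjPart_hook_of_two_le h (by omega)] at hd
      refine sum_mem fun T hT => ?_
      obtain ⟨hTS, hTd⟩ := Finset.mem_powersetCard.1 hT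
      have := Finset.card_le_card hTS
      obtain ⟨U, hUT, hU⟩ := Finset.exists_subset_card_eq (s := T) (n := n - r) (by omega)
      rw [← Finset.prod_sdiff hUT]
      exact Ideal.mul_mem_left _ _ (prod_X_mem_hookIdeal (Finset.subset_univ _) hU)
  · refine Ideal.subset_span ⟨Finset.univ, d + 1, ?_, ?_, rfl⟩
    · simp only [Finset.card_univ, Fintype.card_fin]
      omega
    · simp only [Finset.card_univ, Fintype.card_fin, Nat.sub_self, zero_add, sum_conjPart_hook]
      omega
  · refine Ideal.subset_span ⟨T, n - r, by omega, ?_, ?_⟩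
    · rcases Nat.eq_zero_or_pos r with rfl | hr
      · simp only [Nat.sub_zero] at hT
        rw [hT, Nat.sub_self, zero_add, sum_conjPart_hook]
        omega
      · rw [hT, sum_conjPart_hook_of_two_le h (by omega)]
        omega
    · rw [esymmOn, ← hT, Finset.powersetCard_self, Finset.sum_singleton]

end Tanisaki

/-! ### The superspace Vandermonde -/

section Super

variable {n : ℕ}

lemma superPartial_mul_comm (i j : Fin n) :
    (superPartial i * superPartial j : Module.End ℚ (Superspace n)) =
      superPartial j * superPartial i := by
  refine TensorProduct.ext' fun p t => ?_
  have := LinearMap.congr_fun (pderiv_mul_comm i j) p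
  simp only [Module.End.mul_apply] at this
  simp only [Module.End.mul_apply, superPartial, TensorProduct.map_tmul, this]

lemma diffOp_eq_evalOp (f : MvPolynomial (Fin n) ℚ) :
    diffOp f = evalOp superPartial superPartial_mul_comm f :=
  (evalOp_eq_sum _ _ f).symm

lemma diffOp_tmul (f p : MvPolynomial (Fin n) ℚ) (t : ExteriorAlgebra ℚ (Fin n →₀ ℚ)) :
    diffOp f (p ⊗ₜ[ℚ] t) = polyDiff f p ⊗ₜ[ℚ] t := by
  have : evalOp superPartial superPartial_mul_comm =
      (Module.End.rTensorAlgHom ℚ (MvPolynomial (Fin n) ℚ)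
        (ExteriorAlgebra ℚ (Fin n →₀ ℚ))).comp polyDiff := by
    refine algHom_ext fun i => ?_
    simp only [evalOp_X, AlgHom.comp_apply, polyDiff]
    rfl
  rw [diffOp_eq_evalOp, this]
  rfl

lemma diffOp_mul (f g : MvPolynomial (Fin n) ℚ) (v : Superspace n) :
    diffOp (f * g) v = diffOp f (diffOp g v) := by
  simp only [diffOp_eq_evalOp, map_mul]; rfl

lemma diffOp_one (v : Superspace n) : diffOp 1 v = v := by
  simp only [diffOp_eq_evalOp, map_one]; rfl

lemma diffOp_X (i : Fin n) (v : Superspace n) : diffOp (X i) v = superPartial i v := by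
  rw [diffOp_eq_evalOp, evalOp_X]

lemma superRep_diffOp (w : Equiv.Perm (Fin n)) (f : MvPolynomial (Fin n) ℚ) (v : Superspace n) :
    superRep n w (diffOp f v) = diffOp (rename w f) (superRep n w v) := by
  induction v using TensorProduct.induction_on with
  | zero => simp
  | add x y hx hy => simp only [map_add, hx, hy]
  | tmul p t =>
    rw [diffOp_tmul]
    simp only [superRep, superPerm, MonoidHom.coe_mk, OneHom.coe_mk, AlgHom.toLinearMap_apply,
      Algebra.TensorProduct.map_tmul, diffOp_tmul, rename_polyDiff]

variable {r : ℕ}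

/-- The last `n - r` indices. -/
def tailIdx (h : r ≤ n) (i : Fin (n - r)) : Fin n := ⟨r + i, by omega⟩

/-- The indices split into the first `r` and the last `n - r`. -/
def splitIdx (h : r ≤ n) : Fin r ⊕ Fin (n - r) ≃ Fin n :=
  finSumFinEquiv.trans (finCongr (by omega))

@[simp] lemma splitIdx_inl (h : r ≤ n) (j : Fin r) :
    splitIdx h (Sum.inl j) = Fin.castLE h j := by
  ext; simp [splitIdx]

@[simp] lemma splitIdx_inr (h : r ≤ n) (i : Fin (n - r)) :
    splitIdx h (Sum.inr i) = tailIdx h i := by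
  ext; simp [splitIdx, tailIdx]

@[simp] lemma splitIdx_symm_castLE (h : r ≤ n) (j : Fin r) :
    (splitIdx h).symm (Fin.castLE h j) = Sum.inl j := by
  rw [← splitIdx_inl, Equiv.symm_apply_apply]

@[simp] lemma splitIdx_symm_tailIdx (h : r ≤ n) (i : Fin (n - r)) :
    (splitIdx h).symm (tailIdx h i) = Sum.inr i := by
  rw [← splitIdx_inr, Equiv.symm_apply_apply]

lemma tailIdx_injective (h : r ≤ n) : Function.Injective (tailIdx h) := fun i j hij => by
  have := (splitIdx h).injective (a₁ := Sum.inr i) (a₂ := Sum.inr j) (by simpa using hij)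
  simpa using this

/-- Permutations of the first `r` and of the last `n - r` indices, combined. -/
def blockPerm (h : r ≤ n) (s : Equiv.Perm (Fin r)) (t : Equiv.Perm (Fin (n - r))) :
    Equiv.Perm (Fin n) :=
  (splitIdx h).permCongr (Equiv.sumCongr s t)

@[simp] lemma blockPerm_castLE (h : r ≤ n) (s : Equiv.Perm (Fin r)) (t : Equiv.Perm (Fin (n - r)))
    (j : Fin r) : blockPerm h s t (Fin.castLE h j) = Fin.castLE h (s j) := by
  rw [← splitIdx_inl, blockPerm, Equiv.permCongr_apply, Equiv.symm_apply_apply]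
  simp

@[simp] lemma blockPerm_tailIdx (h : r ≤ n) (s : Equiv.Perm (Fin r))
    (t : Equiv.Perm (Fin (n - r))) (i : Fin (n - r)) :
    blockPerm h s t (tailIdx h i) = tailIdx h (t i) := by
  rw [← splitIdx_inr, blockPerm, Equiv.permCongr_apply, Equiv.symm_apply_apply]
  simp

lemma sign_blockPerm (h : r ≤ n) (s : Equiv.Perm (Fin r)) (t : Equiv.Perm (Fin (n - r))) :
    Equiv.Perm.sign (blockPerm h s t) = Equiv.Perm.sign s * Equiv.Perm.sign t := by
  rw [blockPerm, Equiv.Perm.sign_permCongr, ← Equiv.Perm.sumCongr, Equiv.Perm.sign_sumCongr]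

/-- The product `θ_{u 0} ⋯ θ_{u (r - 1)}` in the exterior algebra. -/
noncomputable def thetaProd (u : Fin r → Fin n) : ExteriorAlgebra ℚ (Fin n →₀ ℚ) :=
  ExteriorAlgebra.ιMulti ℚ r fun j => Finsupp.single (u j) 1

/-- The sign of a permutation as a rational number. -/
abbrev qsign {m : ℕ} (w : Equiv.Perm (Fin m)) : ℚ := ((Equiv.Perm.sign w : ℤ) : ℚ)

lemma qsign_mul_self {m : ℕ} (w : Equiv.Perm (Fin m)) : qsign w * qsign w = 1 := by
  rcases Int.units_eq_one_or (Equiv.Perm.sign w) with h | h <;> simp [qsign, h]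

lemma superRep_startMonomial (h : r ≤ n) (w : Equiv.Perm (Fin n)) :
    superRep n w (startMonomial h fun _ => 0) =
      (∏ i, X (w (tailIdx h i)) ^ (i.rev : ℕ)) ⊗ₜ[ℚ] thetaProd fun j => w (Fin.castLE h j) := by
  have h1 : (∏ i : Fin n, (X i : MvPolynomial (Fin n) ℚ) ^
      (if hi : (i : ℕ) < r then 0 else n - 1 - i)) =
      ∏ i, X (tailIdx h i) ^ (i.rev : ℕ) := by
    rw [← (splitIdx h).prod_comp, Fintype.prod_sum_type]
    simp only [splitIdx_inl, splitIdx_inr, Fin.val_castLE, Fin.is_lt, dif_pos, pow_zero,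
      Finset.prod_const_one, one_mul]
    refine Finset.prod_congr rfl fun i _ => ?_
    rw [dif_neg (by simp [tailIdx]), Fin.val_rev]
    congr 1
    simp only [tailIdx]
    omega
  have h2 : (List.ofFn fun j : Fin r => theta n (Fin.castLE h j)).prod =
      1 ⊗ₜ[ℚ] thetaProd (Fin.castLE h) := by
    rw [thetaProd, ExteriorAlgebra.ιMulti_apply, ← Algebra.TensorProduct.includeRight_apply,
      map_list_prod, List.map_ofFn]
    rfl
  rw [startMonomial, h1, h2, ofPoly, Algebra.TensorProduct.tmul_mul_tmul, mul_one, one_mul]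
  simp only [superRep, superPerm, MonoidHom.coe_mk, OneHom.coe_mk, AlgHom.toLinearMap_apply,
    Algebra.TensorProduct.map_tmul, map_prod, map_pow, rename_X]
  congr 1
  simp only [thetaProd, ExteriorAlgebra.map_apply_ιMulti]
  congr 1
  ext1 j
  simp [Finsupp.lmapDomain_apply]

lemma vandermonde_eq_sum (h : r ≤ n) :
    vandermonde h (fun _ => 0) = ∑ w : Equiv.Perm (Fin n), qsign w •
      ((∏ i, X (w (tailIdx h i)) ^ (i.rev : ℕ)) ⊗ₜ[ℚ] thetaProd fun j => w (Fin.castLE h j)) := by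
  simp only [vandermonde, superRep_startMonomial]

/-- Grouping the terms with the same `θ`-part exhibits Vandermonde determinants as coefficients of
the superspace Vandermonde. -/
lemma factorial_smul_vandermonde (h : r ≤ n) :
    ((n - r).factorial : ℚ) • vandermonde h (fun _ => 0) =
      ∑ w : Equiv.Perm (Fin n), qsign w •
        (vand (fun i => w (tailIdx h i)) ⊗ₜ[ℚ] thetaProd fun j => w (Fin.castLE h j)) := by
  have h1 : ∀ t : Equiv.Perm (Fin (n - r)), ∑ w : Equiv.Perm (Fin n), qsign w •
      ((qsign t • ∏ i, X (w (tailIdx h (t i))) ^ (i.rev : ℕ)) ⊗ₜ[ℚ]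
        thetaProd fun j => w (Fin.castLE h j)) = vandermonde h fun _ => 0 := by
    intro t
    rw [vandermonde_eq_sum]
    refine Fintype.sum_equiv (Equiv.mulRight (blockPerm h 1 t)) _ _ fun w => ?_
    simp only [Equiv.coe_mulRight, Equiv.Perm.mul_apply, blockPerm_castLE, blockPerm_tailIdx,
      Equiv.Perm.one_apply, qsign, Equiv.Perm.sign_mul, sign_blockPerm, Equiv.Perm.sign_one, one_mul,
      Units.val_mul, Int.cast_mul, mul_smul, TensorProduct.smul_tmul']
  have h2 := Finset.sum_congr (rfl : (Finset.univ : Finset (Equiv.Perm (Fin (n - r)))) = _)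
    fun t _ => h1 t
  rw [Finset.sum_const, Finset.card_univ, Fintype.card_perm, Fintype.card_fin, Finset.sum_comm,
    ← Nat.cast_smul_eq_nsmul ℚ] at h2
  rw [← h2]
  refine Finset.sum_congr rfl fun w _ => ?_
  rw [vand, altDet_eq_sum, TensorProduct.sum_tmul, Finset.smul_sum]

/-- The linear functional on the exterior algebra that takes the coefficient of
`θ_{u 0} ⋯ θ_{u (r - 1)}`. -/
noncomputable def thetaCoeff (u : Fin r → Fin n) : ExteriorAlgebra ℚ (Fin n →₀ ℚ) →ₗ[ℚ] ℚ :=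
  ExteriorAlgebra.liftAlternating (Pi.single r
    ((Matrix.detRowAlternating (n := Fin r) (R := ℚ)).compLinearMap
      (LinearMap.pi fun j => Finsupp.lapply (u j))))

lemma thetaCoeff_thetaProd (u v : Fin r → Fin n) :
    thetaCoeff u (thetaProd v) =
      ∑ s : Equiv.Perm (Fin r), qsign s * ∏ j, if v (s j) = u j then 1 else 0 := by
  rw [thetaCoeff, thetaProd, ExteriorAlgebra.liftAlternating_apply_ιMulti, Pi.single_eq_same]
  refine (Matrix.det_apply' _).trans ?_
  refine Finset.sum_congr rfl fun s _ => ?_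
  congr 1
  refine Finset.prod_congr rfl fun j _ => ?_
  simp [Finsupp.single_apply]

/-- The coefficient of `θ_{u 0} ⋯ θ_{u (r - 1)}` of a superpolynomial. -/
noncomputable def superCoeff (u : Fin r → Fin n) : Superspace n →ₗ[ℚ] MvPolynomial (Fin n) ℚ :=
  (TensorProduct.rid ℚ _).toLinearMap ∘ₗ LinearMap.lTensor _ (thetaCoeff u)

lemma superCoeff_tmul (u : Fin r → Fin n) (p : MvPolynomial (Fin n) ℚ)
    (t : ExteriorAlgebra ℚ (Fin n →₀ ℚ)) : superCoeff u (p ⊗ₜ[ℚ] t) = thetaCoeff u t • p := by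
  simp [superCoeff]

lemma superCoeff_diffOp (u : Fin r → Fin n) (f : MvPolynomial (Fin n) ℚ) (v : Superspace n) :
    superCoeff u (diffOp f v) = polyDiff f (superCoeff u v) := by
  induction v using TensorProduct.induction_on with
  | zero => simp
  | add x y hx hy => simp only [map_add, hx, hy]
  | tmul p t => rw [diffOp_tmul, superCoeff_tmul, superCoeff_tmul, map_smul]

/-- The signed sum over the permutations fixing the first `r` indices is a block triangular
determinant. -/
lemma sum_fixing_eq_vand (h : r ≤ n) :
    ∑ v : Equiv.Perm (Fin n), qsign v •
      ((∏ j : Fin r, if v (Fin.castLE h j) = Fin.castLE h j then (1 : ℚ) else 0) •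
        ∏ i, (X (v (tailIdx h i)) : MvPolynomial (Fin n) ℚ) ^ (i.rev : ℕ)) = vand (tailIdx h) := by
  let N : Matrix (Fin n) (Fin n) (MvPolynomial (Fin n) ℚ) := Matrix.of fun x y =>
    Sum.elim (fun j => if x = Fin.castLE h j then 1 else 0) (fun i => X x ^ (i.rev : ℕ))
      ((splitIdx h).symm y)
  have hN : N.submatrix (splitIdx h) (splitIdx h) = Matrix.fromBlocks 1
      (Matrix.of fun j i => X (Fin.castLE h j) ^ (i.rev : ℕ)) 0
      (Matrix.of fun a i => X (tailIdx h a) ^ (i.rev : ℕ)) := by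
    ext1 x y
    rcases x with x | x <;> rcases y with y | y
    · simp [N, Matrix.one_apply]
    · simp [N]
    · have : tailIdx h x ≠ Fin.castLE h y := by
        rw [← splitIdx_inl, ← splitIdx_inr]
        simp only [ne_eq, EmbeddingLike.apply_eq_iff_eq, reduceCtorEq, not_false_eq_true]
      simp [N, this]
    · simp [N]
  have hdet : N.det = vand (tailIdx h) := by
    rw [← Matrix.det_submatrix_equiv_self (splitIdx h), hN, Matrix.det_fromBlocks_zero₂₁,
      Matrix.det_one, one_mul]
    rfl
  rw [← hdet, Matrix.det_apply']
  refine Finset.sum_congr rfl fun v _ => ?_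
  rw [← (splitIdx h).prod_comp, Fintype.prod_sum_type, smul_eq_C_mul, smul_eq_C_mul]
  simp [N, apply_ite]

/-- Up to a nonzero constant, the `θ`-coefficients of the superspace Vandermonde are Vandermonde
determinants. -/
lemma superCoeff_vandermonde (h : r ≤ n) (w : Equiv.Perm (Fin n)) :
    superCoeff (fun j => w (Fin.castLE h j)) (vandermonde h fun _ => 0) =
      (qsign w * r.factorial) • vand (fun i => w (tailIdx h i)) := by
  have h1 : ∀ s : Equiv.Perm (Fin r), ∑ v : Equiv.Perm (Fin n), qsign v •
      ((qsign s * ∏ j : Fin r,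
        if v (Fin.castLE h (s j)) = Fin.castLE h j then (1 : ℚ) else 0) •
        ∏ i, (X (v (tailIdx h i)) : MvPolynomial (Fin n) ℚ) ^ (i.rev : ℕ)) =
          vand (tailIdx h) := by
    intro s
    rw [← sum_fixing_eq_vand]
    refine Fintype.sum_equiv (Equiv.mulRight (blockPerm h s 1)) _ _ fun v => ?_
    simp only [Equiv.coe_mulRight, Equiv.Perm.mul_apply, blockPerm_castLE, blockPerm_tailIdx,
      Equiv.Perm.one_apply, qsign, Equiv.Perm.sign_mul, sign_blockPerm, Equiv.Perm.sign_one, mul_one,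
      Units.val_mul, Int.cast_mul, mul_smul]
  have h2 := Finset.sum_congr (rfl : (Finset.univ : Finset (Equiv.Perm (Fin r))) = _)
    fun s _ => h1 s
  rw [Finset.sum_const, Finset.card_univ, Fintype.card_perm, Fintype.card_fin, Finset.sum_comm,
    ← Nat.cast_smul_eq_nsmul ℚ] at h2
  have h3 : vand (fun i => w (tailIdx h i)) = rename w (vand (tailIdx h)) := by
    rw [vand, vand, rename_altDet]; rfl
  rw [h3, mul_smul, ← map_smul, ← h2, vandermonde_eq_sum, map_sum, map_sum, Finset.smul_sum]
  refine (Fintype.sum_equiv (Equiv.mulLeft w) _ _ fun v => ?_).symm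
  simp only [Equiv.coe_mulLeft, Equiv.Perm.mul_apply, map_smul, superCoeff_tmul,
    thetaCoeff_thetaProd, EmbeddingLike.apply_eq_iff_eq, map_sum, map_prod, map_pow, rename_X,
    qsign, Equiv.Perm.sign_mul, Units.val_mul, Int.cast_mul, mul_smul]
  simp only [Finset.sum_smul, Finset.smul_sum, mul_smul]

lemma exists_perm_comp_tailIdx (h : r ≤ n) {e : Fin (n - r) → Fin n}
    (he : Function.Injective e) : ∃ w : Equiv.Perm (Fin n), ∀ i, w (tailIdx h i) = e i := by
  obtain ⟨w, hw⟩ := (Equiv.Perm.isMultiplyPretransitive (Fin n) (n - r)).exists_smul_eq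
    ⟨tailIdx h, tailIdx_injective h⟩ ⟨e, he⟩
  exact ⟨w, fun i => DFunLike.congr_fun hw i⟩

lemma diffOp_vandermonde_eq_zero_iff (h : r ≤ n) (f : MvPolynomial (Fin n) ℚ) :
    diffOp f (vandermonde h fun _ => 0) = 0 ↔ f ∈ annIdeal Finset.univ (n - r) := by
  constructor
  · intro hf e he _
    obtain ⟨w, hw⟩ := exists_perm_comp_tailIdx h he
    have h1 := superCoeff_diffOp (fun j => w (Fin.castLE h j)) f (vandermonde h fun _ => 0)
    rw [hf, map_zero, superCoeff_vandermonde, map_smul, eq_comm, smul_eq_zero] at h1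
    obtain rfl : (fun i => w (tailIdx h i)) = e := funext hw
    refine h1.resolve_left (mul_ne_zero (fun h0 => ?_) (by exact_mod_cast r.factorial_ne_zero))
    have := qsign_mul_self w
    rw [h0, mul_zero] at this
    exact zero_ne_one this
  · intro hf
    have h1 : ((n - r).factorial : ℚ) • diffOp f (vandermonde h fun _ => 0) = 0 := by
      rw [← map_smul, factorial_smul_vandermonde, map_sum]
      refine Finset.sum_eq_zero fun w _ => ?_
      rw [map_smul, diffOp_tmul, hf (fun i => w (tailIdx h i))
        (w.injective.comp (tailIdx_injective h)) fun _ => Finset.mem_univ _,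
        TensorProduct.zero_tmul, smul_zero]
    exact (smul_eq_zero.1 h1).resolve_left (by exact_mod_cast (n - r).factorial_ne_zero)

/-- The Tanisaki ideal of a hook is the annihilator of the superspace Vandermonde. -/
lemma mem_tanisakiIdeal_hook_iff (h : r < n) (f : MvPolynomial (Fin n) ℚ) :
    f ∈ tanisakiIdeal (hook h) ↔ diffOp f (vandermonde h.le fun _ => 0) = 0 := by
  rw [diffOp_vandermonde_eq_zero_iff, tanisakiIdeal_hook]
  have hk : 0 < n - r := by omega
  exact ⟨fun hf => hookIdeal_le_annIdeal _ hk hf,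
    fun hf => annIdeal_le_hookIdeal _ _ hk (by simp) hf⟩

end Super

/-! ### The grading and the isomorphism -/

section Grading

variable {n r : ℕ}

/-- The projection of superspace to its component of `x`-degree `d`. -/
noncomputable def superComp (n d : ℕ) : Superspace n →ₗ[ℚ] Superspace n :=
  LinearMap.rTensor _ (homogeneousComponent d)

lemma superComp_of_mem {d e : ℕ} {g : Superspace n} (hg : g ∈ xDegree n d) :
    superComp n e g = if e = d then g else 0 := by
  have hle : xDegree n d ≤ LinearMap.eqLocus (superComp n e)
      (if e = d then LinearMap.id else 0) := by
    refine Submodule.span_le.2 ?_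
    rintro _ ⟨p, t, hp, rfl⟩
    simp only [superComp, SetLike.mem_coe, LinearMap.mem_eqLocus, LinearMap.rTensor_tmul,
      homogeneousComponent_of_mem ((mem_homogeneousSubmodule _ _).2 hp)]
    split_ifs <;> simp_all
  have := hle hg
  rw [LinearMap.mem_eqLocus] at this
  rw [this]
  split_ifs <;> rfl

lemma diffOp_mem_xDegree {f : MvPolynomial (Fin n) ℚ} {i d : ℕ} (hf : f.IsHomogeneous i)
    {g : Superspace n} (hg : g ∈ xDegree n d) : diffOp f g ∈ xDegree n (d - i) := by
  have hle : xDegree n d ≤ (xDegree n (d - i)).comap (diffOp f) := by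
    refine Submodule.span_le.2 ?_
    rintro _ ⟨p, t, hp, rfl⟩
    exact Submodule.subset_span ⟨_, t, (polyDiff_isHomogeneous hf hp).1, diffOp_tmul _ _ _⟩
  exact hle hg

lemma diffOp_eq_zero_of_lt {f : MvPolynomial (Fin n) ℚ} {i d : ℕ} (hf : f.IsHomogeneous i)
    (hd : d < i) {g : Superspace n} (hg : g ∈ xDegree n d) : diffOp f g = 0 := by
  have hle : xDegree n d ≤ LinearMap.ker (diffOp f) := by
    refine Submodule.span_le.2 ?_
    rintro _ ⟨p, t, hp, rfl⟩
    simp [diffOp_tmul, (polyDiff_isHomogeneous hf hp).2 hd]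
  exact hle hg

lemma vandermonde_mem_xDegree (h : r ≤ n) :
    vandermonde h (fun _ : Fin r => 0) ∈ xDegree n ((n - r).choose 2) := by
  have h0 : ((n - r).factorial : ℚ) ≠ 0 := by exact_mod_cast (n - r).factorial_ne_zero
  rw [← Submodule.smul_mem_iff _ h0, factorial_smul_vandermonde]
  exact sum_mem fun w _ => Submodule.smul_mem _ _
    (Submodule.subset_span ⟨_, _, vand_isHomogeneous _, rfl⟩)

/-- The linear map `f ↦ ∂(f)(Δ)`. -/
noncomputable def diffVand (h : r ≤ n) : MvPolynomial (Fin n) ℚ →ₗ[ℚ] Superspace n :=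
  (LinearMap.applyₗ (vandermonde h fun _ : Fin r => 0)).comp
    (evalOp superPartial superPartial_mul_comm).toLinearMap

lemma diffVand_apply (h : r ≤ n) (f : MvPolynomial (Fin n) ℚ) :
    diffVand h f = diffOp f (vandermonde h fun _ => 0) := by
  rw [diffOp_eq_evalOp]; rfl

lemma range_diffVand (h : r ≤ n) : LinearMap.range (diffVand h) = V h fun _ : Fin r => 0 := by
  refine le_antisymm ?_ (sInf_le ⟨⟨1, ?_⟩, ?_⟩)
  · rintro _ ⟨f, rfl⟩
    induction f using MvPolynomial.induction_on with
    | C a =>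
      rw [← mul_one (C a), C_mul', map_smul, diffVand_apply, diffOp_one]
      exact Submodule.smul_mem _ _ (vandermonde_mem_V _ _)
    | add f g hf hg =>
      rw [map_add]
      exact add_mem hf hg
    | mul_X f i hf =>
      rw [diffVand_apply, mul_comm, diffOp_mul, diffOp_X, ← diffVand_apply]
      exact superPartial_mem_V _ _ _ hf
  · rw [diffVand_apply, diffOp_one]
  · rintro i _ ⟨f, rfl⟩
    exact ⟨X i * f, by rw [diffVand_apply, diffVand_apply, diffOp_mul, diffOp_X]⟩

lemma superComp_diffVand (h : r ≤ n) (f : MvPolynomial (Fin n) ℚ) (j : ℕ) :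
    superComp n j (diffVand h f) = if j ≤ (n - r).choose 2 then
      diffVand h (homogeneousComponent ((n - r).choose 2 - j) f) else 0 := by
  have h1 : ∀ i, superComp n j (diffVand h (homogeneousComponent i f)) =
      if i + j = (n - r).choose 2 then diffVand h (homogeneousComponent i f) else 0 := by
    intro i
    have hi := homogeneousComponent_isHomogeneous i f
    rw [diffVand_apply]
    by_cases hd : (n - r).choose 2 < i
    · rw [diffOp_eq_zero_of_lt hi hd (vandermonde_mem_xDegree h), map_zero, ite_self]
    · rw [superComp_of_mem (diffOp_mem_xDegree hi (vandermonde_mem_xDegree h))]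
      refine if_congr ?_ rfl rfl
      omega
  conv_lhs => rw [← sum_homogeneousComponent f, map_sum, map_sum]
  simp only [h1]
  split_ifs with hj
  · rw [Finset.sum_eq_single ((n - r).choose 2 - j)]
    · rw [if_pos (by omega)]
    · intro i _ hi
      rw [if_neg (by omega)]
    · intro hi
      rw [Finset.mem_range, not_lt] at hi
      rw [homogeneousComponent_eq_zero _ _ (by omega), map_zero, ite_self]
  · exact Finset.sum_eq_zero fun i _ => if_neg (by omega)

/-- The linear isomorphism `R_λ ≃ V` induced by `f ↦ ∂(f)(Δ)`. -/
noncomputable def tanisakiEquiv (h : r < n) :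
    TanisakiQuotient (hook h) ≃ₗ[ℚ] V h.le fun _ : Fin r => 0 :=
  ((Submodule.Quotient.restrictScalarsEquiv ℚ (tanisakiIdeal (hook h))).symm.trans
    (Submodule.quotEquivOfEq _ (LinearMap.ker (diffVand h.le)) (by
      ext f
      rw [Submodule.restrictScalars_mem, LinearMap.mem_ker, diffVand_apply,
        mem_tanisakiIdeal_hook_iff]))).trans
  ((diffVand h.le).quotKerEquivRange.trans (LinearEquiv.ofEq _ _ (range_diffVand h.le)))

lemma tanisakiEquiv_mk (h : r < n) (f : MvPolynomial (Fin n) ℚ) :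
    (tanisakiEquiv h (Ideal.Quotient.mk _ f) : Superspace n) = diffVand h.le f := rfl

lemma tanisakiEquiv_tanisakiRep (h : r < n) (w : Equiv.Perm (Fin n))
    (f : TanisakiQuotient (hook h)) :
    (tanisakiEquiv h (tanisakiRep (hook h) w f) : Superspace n) =
      qsign w • superRep n w (tanisakiEquiv h f) := by
  obtain ⟨f, rfl⟩ := Ideal.Quotient.mk_surjective f
  have h1 : tanisakiRep (hook h) w (Ideal.Quotient.mk _ f) =
      Ideal.Quotient.mk _ (rename w f) := by simp [tanisakiRep]
  rw [h1, tanisakiEquiv_mk, tanisakiEquiv_mk, diffVand_apply, diffVand_apply, superRep_diffOp,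
    superRep_vandermonde, map_smul, smul_smul, qsign_mul_self, one_smul]

lemma map_tanisakiPiece (h : r < n) {i j : ℕ} (hij : i + j = (n - r).choose 2) :
    (tanisakiPiece (hook h) i).toSubmodule.map
        ((V h.le fun _ : Fin r => 0).subtype ∘ₗ (tanisakiEquiv h).toLinearMap) =
      (VPiece h.le (fun _ : Fin r => 0) j).toSubmodule := by
  apply le_antisymm
  · rintro _ ⟨_, ⟨f, hf, rfl⟩, rfl⟩
    refine ⟨(tanisakiEquiv h (Ideal.Quotient.mk _ f)).2, ?_⟩
    have := diffOp_mem_xDegree (f := f) hf (vandermonde_mem_xDegree h.le)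
    rwa [← diffVand_apply, show (n - r).choose 2 - i = j by omega] at this
  · rintro g ⟨hg, hgj⟩
    rw [SetLike.mem_coe, ← range_diffVand] at hg
    obtain ⟨f, rfl⟩ := hg
    have h1 := superComp_diffVand h.le f j
    rw [superComp_of_mem hgj, if_pos rfl, if_pos (by omega),
      show (n - r).choose 2 - j = i by omega] at h1
    rw [h1]
    exact ⟨_, ⟨_, homogeneousComponent_isHomogeneous i f, rfl⟩, rfl⟩

lemma tanisakiPiece_eq_bot (h : r < n) {i : ℕ} (hi : (n - r).choose 2 < i) :
    (tanisakiPiece (hook h) i).toSubmodule = ⊥ := by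
  refine eq_bot_iff.2 ?_
  rintro _ ⟨f, hf, rfl⟩
  refine (Submodule.mem_bot ℚ).2 (Ideal.Quotient.eq_zero_iff_mem.2 ?_)
  rw [mem_tanisakiIdeal_hook_iff]
  exact diffOp_eq_zero_of_lt hf hi (vandermonde_mem_xDegree h.le)

lemma VPiece_eq_bot (h : r < n) {i : ℕ} (hi : (n - r).choose 2 < i) :
    (VPiece h.le (fun _ : Fin r => 0) i).toSubmodule = ⊥ := by
  refine eq_bot_iff.2 ?_
  rintro g ⟨hg, hgi⟩
  rw [SetLike.mem_coe, ← range_diffVand] at hg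
  obtain ⟨f, rfl⟩ := hg
  have h1 := superComp_diffVand h.le f i
  rwa [superComp_of_mem hgi, if_pos rfl, if_neg (by omega)] at h1

/-- The top component of `R_λ` does not vanish: some operator of order `n - r choose 2` maps the
superspace Vandermonde to a nonzero element. -/
lemma tanisakiPiece_top_ne_bot (h : r < n) :
    (tanisakiPiece (hook h) ((n - r).choose 2)).toSubmodule ≠ ⊥ := by
  obtain ⟨f, hf, hfv⟩ := exists_polyDiff_vand_ne_zero (tailIdx_injective h.le)
  intro hbot
  have h1 : Ideal.Quotient.mk (tanisakiIdeal (hook h)) f ∈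
      (tanisakiPiece (hook h) ((n - r).choose 2)).toSubmodule := ⟨f, hf, rfl⟩
  rw [hbot, Submodule.mem_bot, Ideal.Quotient.eq_zero_iff_mem, mem_tanisakiIdeal_hook_iff,
    diffOp_vandermonde_eq_zero_iff] at h1
  exact hfv (h1 _ (tailIdx_injective h.le) fun _ => Finset.mem_univ _)

end Grading

/-! ### Symmetric functions -/

section SymmetricFunctions

variable {n : ℕ}

lemma prod_map_X_eq_monomial {σ : Type*} [DecidableEq σ] (s : Multiset σ) :
    (s.map (X : σ → MvPolynomial σ ℚ)).prod = monomial (Multiset.toFinsupp s) 1 := by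
  induction s using Multiset.induction_on with
  | empty => simp
  | cons a s ih =>
    rw [Multiset.map_cons, Multiset.prod_cons, ih, X, monomial_mul, one_mul,
      ← Multiset.singleton_add, map_add, Multiset.toFinsupp_singleton]

lemma coeff_hsymm (b : Fin n →₀ ℕ) (m : ℕ) :
    coeff b (hsymm (Fin n) ℚ m) = if b.degree = m then 1 else 0 := by
  simp only [hsymm, coeff_sum, prod_map_X_eq_monomial, coeff_monomial]
  have hcard : (Finsupp.toMultiset b).card = b.degree := by
    rw [Finsupp.card_toMultiset, Finsupp.degree_apply]; rfl
  split_ifs with hb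
  · rw [Finset.sum_eq_single ⟨Finsupp.toMultiset b, hcard.trans hb⟩]
    · simp
    · intro s _ hs
      refine if_neg fun h => hs (Subtype.ext ?_)
      simp [← h]
    · exact fun h => absurd (Finset.mem_univ _) h
  · refine Finset.sum_eq_zero fun s _ => if_neg fun h => hb ?_
    rw [← hcard, ← h, Multiset.toFinsupp_toMultiset]
    exact s.2

lemma coeff_psum_mul (b : Fin n →₀ ℕ) (m : ℕ) (p : MvPolynomial (Fin n) ℚ) :
    coeff b (psum (Fin n) ℚ m * p) =
      ∑ j, if m ≤ b j then coeff (b - Finsupp.single j m) p else 0 := by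
  rw [psum, Finset.sum_mul, coeff_sum]
  refine Finset.sum_congr rfl fun j _ => ?_
  rw [X_pow_eq_monomial, coeff_monomial_mul']
  simp

/-- Newton's identities for the complete homogeneous symmetric polynomials.  The coefficient at a
monomial `x ^ b` of degree `m` counts the pairs `(i, j)` with `1 ≤ i ≤ b j`. -/
lemma mul_hsymm_eq_sum (m : ℕ) :
    (m : MvPolynomial (Fin n) ℚ) * hsymm (Fin n) ℚ m =
      ∑ a ∈ Finset.HasAntidiagonal.antidiagonal m with a.1 < m, hsymm (Fin n) ℚ a.1 * psum (Fin n) ℚ a.2 := by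
  rw [Finset.sum_filter, Finset.Nat.sum_antidiagonal_eq_sum_range_succ_mk, Finset.sum_range_succ,
    if_neg (lt_irrefl _), add_zero]
  ext b
  rw [← map_natCast (C (σ := Fin n) (R := ℚ)), coeff_C_mul, coeff_hsymm, coeff_sum]
  have h1 : ∀ i ∈ Finset.range m, coeff b (if i < m then
      hsymm (Fin n) ℚ i * psum (Fin n) ℚ (m - i) else 0) =
        ∑ j, if m - i ≤ b j ∧ b.degree = m then (1 : ℚ) else 0 := by
    intro i hi
    rw [Finset.mem_range] at hi
    rw [if_pos hi, mul_comm, coeff_psum_mul]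
    refine Finset.sum_congr rfl fun j _ => ?_
    by_cases hj : m - i ≤ b j
    · have h2 : (b - Finsupp.single j (m - i)).degree + (m - i) = b.degree := by
        have : b - Finsupp.single j (m - i) + Finsupp.single j (m - i) = b :=
          tsub_add_cancel_of_le (by simpa using hj)
        conv_rhs => rw [← this, map_add, Finsupp.degree_single]
      rw [if_pos hj, coeff_hsymm]
      refine if_congr ?_ rfl rfl
      omega
    · rw [if_neg hj, if_neg (by tauto)]
  rw [Finset.sum_congr rfl h1, Finset.sum_comm]
  by_cases hb : b.degree = m
  · have h3 : ∀ j, ∑ i ∈ Finset.range m, (if m - i ≤ b j ∧ b.degree = m then (1 : ℚ) else 0) =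
        b j := by
      intro j
      have hj : b j ≤ m := hb ▸ Finsupp.le_degree j b
      rw [Finset.sum_boole]
      have : (Finset.range m).filter (fun i => m - i ≤ b j ∧ b.degree = m) =
          Finset.Ico (m - b j) m := by
        ext i
        simp only [Finset.mem_filter, Finset.mem_range, Finset.mem_Ico]
        omega
      rw [this, Nat.card_Ico, Nat.sub_sub_self hj]
    rw [Finset.sum_congr rfl fun j _ => h3 j, if_pos hb, mul_one, ← Nat.cast_sum,
      ← Finsupp.degree_eq_sum, hb]
  · simp [hb]

/-- The symmetric polynomial `e_m`. -/
noncomputable def symE (n m : ℕ) : Sym n := ⟨esymm (Fin n) ℚ m, esymm_isSymmetric (Fin n) ℚ m⟩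

/-- The symmetric polynomial `h_m`. -/
noncomputable def symH (n m : ℕ) : Sym n := ⟨hsymm (Fin n) ℚ m, hsymm_isSymmetric (Fin n) ℚ m⟩

/-- The symmetric polynomial `p_m`. -/
noncomputable def symP (n m : ℕ) : Sym n := ⟨psum (Fin n) ℚ m, psum_isSymmetric (Fin n) ℚ m⟩

lemma omega_symE {m : ℕ} (h0 : 0 < m) (hm : m ≤ n) : omega n (symE n m) = symH n m := by
  obtain ⟨m, rfl⟩ : ∃ l, m = l + 1 := ⟨m - 1, by omega⟩
  have h1 : (esymmAlgEquiv (Fin n) ℚ (Fintype.card_fin n)).symm (symE n (m + 1)) =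
      X (⟨m, by omega⟩ : Fin n) :=
    esymmAlgEquiv_symm_apply ℚ (Fintype.card_fin n) (⟨m, by omega⟩ : Fin n)
  simp only [omega, AlgHom.comp_apply]
  refine (congrArg _ h1).trans ?_
  rw [aeval_X]
  rfl

lemma symP_eq (m : ℕ) (h0 : 0 < m) : symP n m = (-1) ^ (m + 1) * m * symE n m -
    ∑ a ∈ Finset.HasAntidiagonal.antidiagonal m with a.1 ∈ Set.Ioo 0 m, (-1) ^ a.1 * symE n a.1 * symP n a.2 := by
  apply Subtype.ext
  simp only [symP, symE]
  push_cast
  exact psum_eq_mul_esymm_sub_sum (Fin n) ℚ m h0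

lemma symP_eq_symH (m : ℕ) (h0 : 0 < m) : symP n m = m * symH n m -
    ∑ a ∈ Finset.HasAntidiagonal.antidiagonal m with a.1 ∈ Set.Ioo 0 m, symH n a.1 * symP n a.2 := by
  have h1 : (Finset.HasAntidiagonal.antidiagonal m).filter (fun a => a.1 < m) =
      insert (0, m) ((Finset.HasAntidiagonal.antidiagonal m).filter fun a => a.1 ∈ Set.Ioo 0 m) := by
    ext ⟨a, b⟩
    simp only [Finset.mem_filter, Finset.HasAntidiagonal.mem_antidiagonal, Finset.mem_insert, Prod.mk.injEq,
      Set.mem_Ioo]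
    omega
  have h2 := mul_hsymm_eq_sum (n := n) m
  rw [h1, Finset.sum_insert (by simp), hsymm_zero, one_mul] at h2
  apply Subtype.ext
  simp only [symP, symH]
  push_cast
  rw [h2, add_sub_cancel_right]

lemma omega_symP {m : ℕ} (h0 : 0 < m) (hm : m ≤ n) :
    omega n (symP n m) = (-1) ^ (m + 1) * symP n m := by
  induction m using Nat.strong_induction_on with
  | _ m ih =>
    conv_lhs => rw [symP_eq m h0]
    rw [symP_eq_symH m h0, map_sub, map_mul, map_mul, map_pow, map_neg, map_one, map_natCast,
      omega_symE h0 hm, map_sum, mul_sub, Finset.mul_sum, mul_assoc]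
    congr 1
    refine Finset.sum_congr rfl fun a ha => ?_
    simp only [Finset.mem_filter, Finset.HasAntidiagonal.mem_antidiagonal, Set.mem_Ioo] at ha
    rw [map_mul, map_mul, map_pow, map_neg, map_one, omega_symE ha.2.1 (by omega),
      ih a.2 (by omega) (by omega) (by omega)]
    have : (-1 : Sym n) ^ (m + 1) = (-1) ^ a.1 * (-1) ^ (a.2 + 1) := by
      rw [← pow_add, ← ha.1, add_assoc]
    rw [this]
    ring

lemma cyclePsum_eq (w : Equiv.Perm (Fin n)) :
    cyclePsum w = (w.partition.parts.map (symP n)).prod := rfl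

lemma prod_parts_sign (w : Equiv.Perm (Fin n)) :
    (w.partition.parts.map fun m => (-1 : ℤˣ) ^ (m + 1)).prod = Equiv.Perm.sign w := by
  rw [Equiv.Perm.sign_of_cycleType', Equiv.Perm.parts_partition, Multiset.map_add,
    Multiset.prod_add, Multiset.map_replicate, Multiset.prod_replicate]
  simp [pow_succ]

/-- The involution `ω` multiplies the power sum of the cycle type of `w` by the sign of `w`. -/
lemma omega_cyclePsum (w : Equiv.Perm (Fin n)) : omega n (cyclePsum w) = qsign w • cyclePsum w := by
  have h1 : ∀ m ∈ w.partition.parts, omega n (symP n m) = (-1) ^ (m + 1) * symP n m := by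
    intro m hm
    refine omega_symP (w.partition.parts_pos hm) ?_
    have := Multiset.le_sum_of_mem hm
    rwa [w.partition.parts_sum, Fintype.card_fin] at this
  have h2 : (w.partition.parts.map fun m => (-1 : Sym n) ^ (m + 1)).prod =
      algebraMap ℚ (Sym n) (qsign w) := by
    rw [qsign, ← prod_parts_sign]
    have h3 := map_multiset_prod (((Int.castRingHom (Sym n)).toMonoidHom).comp (Units.coeHom ℤ))
      (w.partition.parts.map fun m => (-1 : ℤˣ) ^ (m + 1))
    rw [Multiset.map_map] at h3
    rw [map_intCast]
    refine Eq.trans ?_ h3.symm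
    congr 1
    refine Multiset.map_congr rfl fun m _ => ?_
    simp
  rw [cyclePsum_eq, map_multiset_prod, Multiset.map_map, Algebra.smul_def, ← h2,
    ← Multiset.prod_map_mul]
  exact congrArg _ (Multiset.map_congr rfl h1)

/-! ### Frobenius images -/

section Frobenius

variable {M N : Type} [AddCommGroup M] [Module ℚ M] [AddCommGroup N] [Module ℚ N]

/-- Twisting a representation by the sign applies `ω` to its Frobenius image. -/
lemma frob_eq_omega_frob (ρ : Representation ℚ (Equiv.Perm (Fin n)) M)
    (σ : Representation ℚ (Equiv.Perm (Fin n)) N) (e : M ≃ₗ[ℚ] N)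
    (he : ∀ w x, e (ρ w x) = qsign w • σ w (e x)) : frob σ = omega n (frob ρ) := by
  have hchar : ∀ w, σ.character w = qsign w * ρ.character w := by
    intro w
    have h1 : σ w = qsign w • e.conj (ρ w) := by
      refine LinearMap.ext fun y => ?_
      rw [LinearMap.smul_apply, LinearEquiv.conj_apply_apply, he, smul_smul, qsign_mul_self,
        one_smul, LinearEquiv.apply_symm_apply]
    rw [Representation.character, h1, map_smul, LinearMap.trace_conj', smul_eq_mul]
    rfl
  rw [frob, frob, map_smul, map_sum]
  congr 1
  refine Finset.sum_congr rfl fun w _ => ?_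
  rw [map_smul, omega_cyclePsum, hchar, smul_smul, mul_comm]

lemma frob_eq_zero_of_subsingleton [Subsingleton M]
    (ρ : Representation ℚ (Equiv.Perm (Fin n)) M) : frob ρ = 0 := by
  have h1 : ∀ w, ρ.character w = 0 := fun w => by
    rw [Representation.character, Subsingleton.elim (ρ w) 0, map_zero]
  simp [frob, h1]

lemma coeff_indicator_psum_one_pow (S : Finset (Fin n)) :
    coeff (∑ i ∈ S, Finsupp.single i 1) (psum (Fin n) ℚ 1 ^ S.card) = S.card.factorial := by
  induction hS : S.card generalizing S with
  | zero =>
    rw [Finset.card_eq_zero] at hS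
    simp [hS]
  | succ k ih =>
    have happ : ∀ j, (∑ i ∈ S, Finsupp.single i 1 : Fin n →₀ ℕ) j = if j ∈ S then 1 else 0 := by
      intro j
      simp [Finsupp.finsetSum_apply, Finsupp.single_apply]
    rw [pow_succ', coeff_psum_mul]
    have h1 : ∀ j, (if 1 ≤ (∑ i ∈ S, Finsupp.single i 1 : Fin n →₀ ℕ) j then
        coeff (∑ i ∈ S, Finsupp.single i 1 - Finsupp.single j 1) (psum (Fin n) ℚ 1 ^ k) else 0) =
          if j ∈ S then (k.factorial : ℚ) else 0 := by
      intro j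
      rw [happ]
      by_cases hj : j ∈ S
      · have h2 : (S.erase j).card = k := by rw [Finset.card_erase_of_mem hj, hS]; rfl
        rw [if_pos hj, if_pos hj, if_pos le_rfl, ← Finset.add_sum_erase _ _ hj,
          add_tsub_cancel_left, ih _ h2]
      · simp [hj]
    rw [Finset.sum_congr rfl fun j _ => h1 j, Finset.sum_ite_mem, Finset.univ_inter,
      Finset.sum_const, hS, Nat.factorial_succ]
    simp

/-- The coefficient of `x₁ ⋯ xₙ` in a power sum `p_μ` vanishes unless `μ = (1, …, 1)`. -/
lemma coeff_indicator_cyclePsum (w : Equiv.Perm (Fin n)) :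
    coeff (∑ i, Finsupp.single i 1) (cyclePsum w : MvPolynomial (Fin n) ℚ) =
      if w = 1 then (n.factorial : ℚ) else 0 := by
  split_ifs with hw
  · have h1 : (cyclePsum w : MvPolynomial (Fin n) ℚ) = psum (Fin n) ℚ 1 ^ n := by
      rw [cyclePsum_eq, Equiv.Perm.parts_partition, hw]
      simp [symP]
    have h2 := coeff_indicator_psum_one_pow (Finset.univ : Finset (Fin n))
    rw [Finset.card_univ, Fintype.card_fin] at h2
    rw [h1, h2]
  · obtain ⟨m, hm⟩ := Multiset.exists_mem_of_ne_zero (mt Equiv.Perm.cycleType_eq_zero.1 hw)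
    have h2 : 2 ≤ m := Equiv.Perm.two_le_of_mem_cycleType hm
    have hmem : m ∈ w.partition.parts := by
      rw [Equiv.Perm.parts_partition]
      exact Multiset.mem_add.2 (Or.inl hm)
    obtain ⟨t, ht⟩ := Multiset.exists_cons_of_mem hmem
    have h3 : (cyclePsum w : MvPolynomial (Fin n) ℚ) =
        psum (Fin n) ℚ m * ((t.map (symP n)).prod : Sym n) := by
      rw [cyclePsum_eq, ht, Multiset.map_cons, Multiset.prod_cons]
      rfl
    rw [h3, coeff_psum_mul]
    refine Finset.sum_eq_zero fun j _ => if_neg ?_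
    simp [Finsupp.finsetSum_apply, Finsupp.single_apply]
    omega

/-- The Frobenius image determines the dimension, hence is nonzero for a nonzero representation. -/
lemma frob_ne_zero [FiniteDimensional ℚ M] [Nontrivial M]
    (ρ : Representation ℚ (Equiv.Perm (Fin n)) M) : frob ρ ≠ 0 := by
  intro h0
  have h1 : coeff (∑ i, Finsupp.single i 1) (frob ρ : MvPolynomial (Fin n) ℚ) =
      Module.finrank ℚ M := by
    have h2 : (frob ρ : MvPolynomial (Fin n) ℚ) = (1 / (n.factorial : ℚ)) •
        ∑ w : Equiv.Perm (Fin n), ρ.character w • (cyclePsum w : MvPolynomial (Fin n) ℚ) := by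
      simp [frob]
    rw [h2, coeff_smul, coeff_sum]
    simp only [coeff_smul, coeff_indicator_cyclePsum, smul_eq_mul, mul_ite, mul_zero,
      Finset.sum_ite_eq', Finset.mem_univ, if_true]
    rw [Representation.char_one]
    have : (n.factorial : ℚ) ≠ 0 := by exact_mod_cast n.factorial_ne_zero
    field_simp
  rw [h0, ZeroMemClass.coe_zero, coeff_zero] at h1
  have : 0 < Module.finrank ℚ M := Module.finrank_pos
  have h3 : Module.finrank ℚ M = 0 := by exact_mod_cast h1.symm
  omega

end Frobenius

end SymmetricFunctions

/-! ### Graded Frobenius images for the hook -/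

section HookPieces

variable {n r : ℕ}

lemma frob_VPiece (h : r < n) {i j : ℕ} (hij : i + j = (n - r).choose 2) :
    frob (M := (VPiece h.le (fun _ : Fin r => 0) j).toSubmodule)
      (VPiece h.le (fun _ : Fin r => 0) j).toRepresentation =
      omega n (frob (tanisakiPiece (hook h) i).toRepresentation) := by
  have hmap := map_tanisakiPiece h hij
  have hinj : Function.Injective
      ((V h.le fun _ : Fin r => 0).subtype ∘ₗ (tanisakiEquiv h).toLinearMap) :=
    Subtype.val_injective.comp (tanisakiEquiv h).injective
  refine frob_eq_omega_frob _ _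
    ((Submodule.equivMapOfInjective _ hinj _).trans (LinearEquiv.ofEq _ _ hmap)) fun w x => ?_
  exact Subtype.ext (tanisakiEquiv_tanisakiRep h w x)

lemma frob_VPiece_eq_zero (h : r < n) {j : ℕ} (hj : (n - r).choose 2 < j) :
    frob (M := (VPiece h.le (fun _ : Fin r => 0) j).toSubmodule)
      (VPiece h.le (fun _ : Fin r => 0) j).toRepresentation = 0 := by
  have : Subsingleton (VPiece h.le (fun _ : Fin r => 0) j).toSubmodule :=
    Submodule.subsingleton_iff_eq_bot.2 (VPiece_eq_bot h hj)
  exact frob_eq_zero_of_subsingleton _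

lemma frob_tanisakiPiece_eq_zero (h : r < n) {j : ℕ} (hj : (n - r).choose 2 < j) :
    frob (tanisakiPiece (hook h) j).toRepresentation = 0 := by
  have : Subsingleton (tanisakiPiece (hook h) j).toSubmodule :=
    Submodule.subsingleton_iff_eq_bot.2 (tanisakiPiece_eq_bot h hj)
  exact frob_eq_zero_of_subsingleton _

/-- The component of degree `0` of `V` corresponds to the top component of `R_λ`, which is finite
dimensional and nonzero. -/
lemma frob_VPiece_zero_ne_zero (h : r < n) :
    frob (M := (VPiece h.le (fun _ : Fin r => 0) 0).toSubmodule)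
      (VPiece h.le (fun _ : Fin r => 0) 0).toRepresentation ≠ 0 := by
  have hmap := map_tanisakiPiece h (add_zero ((n - r).choose 2))
  have hinj : Function.Injective
      ((V h.le fun _ : Fin r => 0).subtype ∘ₗ (tanisakiEquiv h).toLinearMap) :=
    Subtype.val_injective.comp (tanisakiEquiv h).injective
  have : FiniteDimensional ℚ (VPiece h.le (fun _ : Fin r => 0) 0).toSubmodule := by
    refine Module.Finite.iff_fg.2 ?_
    rw [← hmap]
    exact ((homogeneousSubmodule_fg (σ := Fin n) (R := ℚ) _).map _).map _
  have : Nontrivial (VPiece h.le (fun _ : Fin r => 0) 0).toSubmodule := by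
    rw [Submodule.nontrivial_iff_ne_bot, ← hmap]
    exact fun hb => tanisakiPiece_top_ne_bot h
      (Submodule.map_injective_of_injective hinj (hb.trans (Submodule.map_bot _).symm))
  exact frob_ne_zero _

/-- A power series whose coefficients vanish beyond `D` is a polynomial. -/
lemma exists_polynomial_coe_eq {R : Type*} [CommSemiring R] (P : R⟦X⟧) (D : ℕ)
    (hP : ∀ d, D < d → PowerSeries.coeff d P = 0) : ∃ F : R[X], (F : R⟦X⟧) = P := by
  refine ⟨PowerSeries.trunc (D + 1) P, ?_⟩
  ext d
  rw [Polynomial.coeff_coe, PowerSeries.coeff_trunc]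
  split_ifs with hd
  · rfl
  · exact (hP d (by omega)).symm

end HookPieces

end SuperVandermonde

open SuperVandermonde in
theorem proposition4p3 (n r : ℕ) (h : r < n) :
    -- the Tanisaki ideal is the annihilator of the superspace Vandermonde
    (∀ f : MvPolynomial (Fin n) ℚ,
      f ∈ tanisakiIdeal (hook h) ↔ diffOp f (vandermonde h.le fun _ : Fin r => 0) = 0) ∧
    -- isomorphism up to sign twist and grading reversal, with top degree `(n - r).choose 2`
    (∃ φ : TanisakiQuotient (hook h) ≃ₗ[ℚ] V h.le fun _ : Fin r => 0,
      (∀ (w : Equiv.Perm (Fin n)) (f : TanisakiQuotient (hook h)),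
        (φ (tanisakiRep (hook h) w f) : Superspace n) =
          ((Equiv.Perm.sign w : ℤ) : ℚ) • superRep n w (φ f)) ∧
      (∀ i j : ℕ, i + j = (n - r).choose 2 →
        (tanisakiPiece (hook h) i).toSubmodule.map
            ((V h.le fun _ : Fin r => 0).subtype ∘ₗ φ.toLinearMap) =
          (VPiece h.le (fun _ : Fin r => 0) j).toSubmodule) ∧
      (∀ i : ℕ, (n - r).choose 2 < i →
        (tanisakiPiece (hook h) i).toSubmodule = ⊥ ∧
          (VPiece h.le (fun _ : Fin r => 0) i).toSubmodule = ⊥)) ∧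
    -- both graded Frobenius images are polynomials in `q`, and they are related by `rev_q ∘ ω`
    (∃ F G : (Sym n)[X],
      (F : (Sym n)⟦X⟧) = grFrob (VPiece h.le fun _ : Fin r => 0) ∧
      (G : (Sym n)⟦X⟧) = grFrob (tanisakiPiece (hook h)) ∧
      F = (G.map (omega n).toRingHom).reverse) := by
  refine ⟨mem_tanisakiIdeal_hook_iff h, ⟨tanisakiEquiv h, tanisakiEquiv_tanisakiRep h,
    fun i j hij => map_tanisakiPiece h hij,
    fun i hi => ⟨tanisakiPiece_eq_bot h hi, VPiece_eq_bot h hi⟩⟩, ?_⟩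
  obtain ⟨F, hF⟩ := exists_polynomial_coe_eq (grFrob (VPiece h.le fun _ : Fin r => 0))
    ((n - r).choose 2) fun d hd => by
      rw [grFrob, PowerSeries.coeff_mk, frob_VPiece_eq_zero h hd]
  obtain ⟨G, hG⟩ := exists_polynomial_coe_eq (grFrob (tanisakiPiece (hook h)))
    ((n - r).choose 2) fun d hd => by
      rw [grFrob, PowerSeries.coeff_mk, frob_tanisakiPiece_eq_zero h hd]
  refine ⟨F, G, hF, hG, ?_⟩
  have hFc : ∀ d, F.coeff d = frob (M := (VPiece h.le (fun _ : Fin r => 0) d).toSubmodule)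
      (VPiece h.le (fun _ : Fin r => 0) d).toRepresentation := by
    intro d
    rw [← Polynomial.coeff_coe, hF, grFrob, PowerSeries.coeff_mk]
  have hGc : ∀ d, (G.map (omega n).toRingHom).coeff d =
      omega n (frob (tanisakiPiece (hook h) d).toRepresentation) := by
    intro d
    rw [Polynomial.coeff_map, ← Polynomial.coeff_coe, hG, grFrob, PowerSeries.coeff_mk]
    rfl
  -- the leading coefficient is the Frobenius image of the bottom component of `V`, so it is nonzero
  have hdeg : (G.map (omega n).toRingHom).natDegree = (n - r).choose 2 := by
    refine Polynomial.natDegree_eq_of_le_of_coeff_ne_zero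
      (Polynomial.natDegree_le_iff_coeff_eq_zero.2 fun d hd => ?_) ?_
    · rw [hGc, frob_tanisakiPiece_eq_zero h hd, map_zero]
    · rw [hGc, ← frob_VPiece h (add_zero _)]
      exact frob_VPiece_zero_ne_zero h
  ext1 d
  rw [Polynomial.coeff_reverse, hdeg, hGc, hFc]
  by_cases hd : d ≤ (n - r).choose 2
  · rw [Polynomial.revAt_le hd]
    exact frob_VPiece h (by omega)
  · rw [Polynomial.revAt_eq_self_of_lt (by omega), frob_VPiece_eq_zero h (by omega),
      frob_tanisakiPiece_eq_zero h (by omega), map_zero]
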